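/- All fields have characteristic zero. A difference field $(F,\sigma)$ is a field $F$ with a field automorphism $\sigma$; its constant field is $\{c\in F:\sigma(c)=c\}$. An extension $(F(t),\sigma)$ of $(F,\sigma)$ is a $\Sigma^*$-extension (resp. $\Pi$-extension) if $t$ is transcendental over $F$, $\sigma(t)=t+a$ (resp. $\sigma(t)=a\,t$) for some $a\in F\setminus\{0\}$, and $F(t)$ has the same constants as $F$. A tower of such steps is called a $\Pi\Sigma^*$-extension, and a $\Sigma^*$-extension if all its steps are $\Sigma^*$-extensions. Let $(F,\sigma)$ with $F=G(t_1)\dots(t_e)$ be a $\Pi\Sigma^*$-extension of $(G,\sigma)$ with $\sigma(t_i)=a_i t_i$ or $\sigma(t_i)=t_i+a_i$, where $a_i\in G(t_1)\dots(t_{i-1})$. The depth $\delta$ over $G$ is defined recursively by $\delta(t_i)=\delta(a_i)+1$, where for $g=g_1/g_2$ with coprime $g_1,g_2\in G[t_1,\dots,t_e]$ one sets $\delta(g)=\max(\{\delta(t_j): t_j \text{ occurs in } g_1 \text{ or } g_2\}\cup\{0\})$. The extension depth of an extension $F(s_1)\dots(s_r)$ of $F$ is $\max(0,\delta(s_1),\dots,\delta(s_r))$.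 A $\Sigma^*$-extension $(H(s),\sigma)$ of $(H,\sigma)$ with $\sigma(s)=s+f$, where $H$ is a $\Pi\Sigma^*$-extension of $G$, is depth-optimal if there is no $\Sigma^*$-extension $(E,\sigma)$ of $(H,\sigma)$ of extension depth $\le\delta(f)$ with some $g\in E$ such that $\sigma(g)-g=f$. A $\Pi\Sigma^\delta$-extension is a $\Pi\Sigma^*$-extension in which every $\Sigma^*$-step is depth-optimal. Theorem. Let $(G(t_1)\dots(t_e),\sigma)$ be a $\Pi\Sigma^*$-extension of $(G,\sigma)$ with $\sigma(t_i)=a_it_i$ or $\sigma(t_i)=t_i+a_i$ as above, and let $\tau\in S_e$ be a permutation with $a_{\tau(i)}\in G(t_{\tau(1)})\dots(t_{\tau(i-1)})$ for all $1\le i\le e$. Then $(G(t_{\tau(1)})\dots(t_{\tau(e)}),\sigma)$ is again a $\Pi\Sigma^*$-extension of $(G,\sigma)$, and it is a $\Pi\Sigma^\delta$-extension of $(G,\sigma)$ if and only if $(G(t_1)\dots(t_e),\sigma)$ is. In particular, any such reordering of a $\Pi\Sigma^\delta$-extension of $G$ is again a $\Pi\Sigma^\delta$-extension of $G$. -/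

import Mathlib

universe u v

namespace DiffField

section

variable (G : Type u) [Field G] {F : Type v} [Field F] [Algebra G F]

/-- `(F, σ)` is a difference field extension of the difference field `(G, σG)`
(along the embedding `algebraMap G F`). -/
def IsExtension {G : Type u} [Field G] [Algebra G F] (σG : G ≃+* G) (σ : F ≃+* F) : Prop :=
  ∀ g : G, σ (algebraMap G F g) = algebraMap G F (σG g)

/-- The field `G(t₁)…(tₘ)` generated over `G` by the first `m` entries of the tuple `t`. -/
def level {e : ℕ} (t : Fin e → F) (m : ℕ) : IntermediateField G F :=
  IntermediateField.adjoin G (t '' {j | j.val < m})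

variable {G}

/-- One step `K ≤ K(x)` with `σ x = x + a` is a `Σ*`-extension: `x` is transcendental over `K`,
`a ∈ K` is nonzero, and `K(x)` has no new constants. -/
structure IsSigmaStep (σ : F ≃+* F) (K : IntermediateField G F) (x a : F) : Prop where
  transcendental : Transcendental K x
  mem : a ∈ K
  ne_zero : a ≠ 0
  shift : σ x = x + a
  const : ∀ c ∈ IntermediateField.adjoin K {x}, σ c = c → c ∈ K

/-- One step `K ≤ K(x)` with `σ x = a x` is a `Π`-extension: `x` is transcendental over `K`,
`a ∈ K` is nonzero, and `K(x)` has no new constants. -/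
structure IsPiStep (σ : F ≃+* F) (K : IntermediateField G F) (x a : F) : Prop where
  transcendental : Transcendental K x
  mem : a ∈ K
  ne_zero : a ≠ 0
  shift : σ x = a * x
  const : ∀ c ∈ IntermediateField.adjoin K {x}, σ c = c → c ∈ K

/-- `(F, σ)` with `F = G(t₁)…(tₑ)` and `σ tᵢ = aᵢ tᵢ` or `σ tᵢ = tᵢ + aᵢ` is a
`ΠΣ*`-extension of `(G, σG)`. -/
structure IsPiSigmaStar (σG : G ≃+* G) (σ : F ≃+* F) {e : ℕ} (t a : Fin e → F) : Prop where
  isExtension : IsExtension σG σ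
  step : ∀ i : Fin e, IsPiStep σ (level G t i) (t i) (a i) ∨ IsSigmaStep σ (level G t i) (t i) (a i)
  top : IntermediateField.adjoin G (Set.range t) = ⊤

variable (G)

/-- `tⱼ` occurs in the numerator or the denominator of `g`, written as a quotient of two coprime
polynomials in `G[t₁, …, tₑ]`. For `t` algebraically independent over `G` (as in every
`ΠΣ*`-extension) this representation is unique up to a factor in `Gˣ`. -/
def Occurs {e : ℕ} (t : Fin e → F) (j : Fin e) (g : F) : Prop :=
  ∃ p q : MvPolynomial (Fin e) G, IsRelPrime p q ∧ MvPolynomial.aeval t q ≠ 0 ∧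
    g = MvPolynomial.aeval t p / MvPolynomial.aeval t q ∧ (j ∈ p.vars ∨ j ∈ q.vars)

open Classical in
/-- The depth `δ(tᵢ) = δ(aᵢ) + 1` of a generator, where `δ(aᵢ)` is the maximum of `0` and the
depths of the generators that occur in `aᵢ`; as `aᵢ ∈ G(t₁)…(tᵢ₋₁)`, only the `tⱼ` with `j < i`
can occur. -/
noncomputable def genDepth {e : ℕ} (t a : Fin e → F) (i : Fin e) : ℕ :=
  (Finset.univ : Finset (Fin i.val)).sup (fun j =>
    if Occurs G t (Fin.castLE i.isLt.le j) (a i) then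
      genDepth t a (Fin.castLE i.isLt.le j) else 0) + 1
termination_by i.val
decreasing_by exact j.isLt

open Classical in
/-- The depth `δ(g)` of `g ∈ G(t₁)…(tₑ)` over `G`: the maximum of `0` and the depths of the
generators that occur in `g`. -/
noncomputable def depth {e : ℕ} (t a : Fin e → F) (g : F) : ℕ :=
  (Finset.univ : Finset (Fin e)).sup (fun j => if Occurs G t j g then genDepth G t a j else 0)

variable {G}

/-- `(E, σ')` is a `Σ*`-extension `Fₘ(s₁)…(sᵣ)` of `(Fₘ, σ)`, where `Fₘ = G(t₁)…(tₘ)`. The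
inclusion of `Fₘ` is `ι`, and `T` lists `t₁, …, tₘ` (as elements of `E`) followed by
`s₁, …, sᵣ`, with the coefficients of all these generators in `A`. -/
structure IsSigmaStarOver (σ : F ≃+* F) {e : ℕ} (t a : Fin e → F) {m : ℕ} (hm : m ≤ e)
    {E : Type v} [Field E] [Algebra G E] (σ' : E ≃+* E) (ι : level G t m →ₐ[G] E)
    {r : ℕ} (T A : Fin (m + r) → E) : Prop where
  comm : ∀ x y : level G t m, σ (x : F) = y → σ' (ι x) = ι y
  gen : ∀ j : Fin m, ∃ x : level G t m,
    (x : F) = t (Fin.castLE hm j) ∧ T (Fin.castAdd r j) = ι x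
  coeff : ∀ j : Fin m, ∃ x : level G t m,
    (x : F) = a (Fin.castLE hm j) ∧ A (Fin.castAdd r j) = ι x
  step : ∀ k : Fin r,
    IsSigmaStep σ' (level G T (m + k)) (T (Fin.natAdd m k)) (A (Fin.natAdd m k))
  top : IntermediateField.adjoin G (Set.range T) = ⊤

variable (G)

/-- The extension depth of `Fₘ(s₁)…(sᵣ)` over `Fₘ`: the maximum of `0` and the depths (over `G`)
of the last `r` generators. -/
noncomputable def extDepth {m r : ℕ} (T A : Fin (m + r) → F) : ℕ :=
  (Finset.univ : Finset (Fin r)).sup (fun k => genDepth G T A (Fin.natAdd m k))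

/-- Depth-optimality of the generator `tᵢ` with `σ tᵢ = tᵢ + f`, `f = aᵢ`: no `Σ*`-extension
`(E, σ')` of `G(t₁)…(tᵢ₋₁)` of extension depth `≤ δ(f)` contains a solution `g` of
`σ' g - g = f`. -/
def IsDepthOptimal (σ : F ≃+* F) {e : ℕ} (t a : Fin e → F) (i : Fin e) : Prop :=
  ¬ ∃ (E : Type v) (_ : Field E) (_ : Algebra G E) (σ' : E ≃+* E)
      (ι : level G t i.val →ₐ[G] E) (r : ℕ) (T A : Fin (i.val + r) → E),
      IsSigmaStarOver σ t a i.isLt.le σ' ι T A ∧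
      extDepth G T A ≤ depth G t a (a i) ∧
      ∃ (f : level G t i.val) (g : E), (f : F) = a i ∧ σ' g - g = ι f

variable {G}

/-- A `ΠΣ^δ`-extension: a `ΠΣ*`-extension all of whose `Σ*`-steps are depth-optimal. -/
def IsPiSigmaDelta (σG : G ≃+* G) (σ : F ≃+* F) {e : ℕ} (t a : Fin e → F) : Prop :=
  IsPiSigmaStar σG σ t a ∧
    ∀ i : Fin e, IsSigmaStep σ (level G t i) (t i) (a i) → IsDepthOptimal G σ t a i

variable (G)

/-- The permutation `τ` is a possible reordering of the tower: `a_{τ(i)}` lies in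
`G(t_{τ(1)})…(t_{τ(i-1)})` for all `i`. -/
def IsAdmissible {e : ℕ} (t a : Fin e → F) (τ : Equiv.Perm (Fin e)) : Prop :=
  ∀ i : Fin e, a (τ i) ∈ level G (t ∘ τ) i

end

end DiffField

/-! The generators are algebraically independent and every constant of `F` lies in `G`
(`IsPiSigmaStar.const`). Both facts ignore the order, so an admissible reordering is again a
`ΠΣ*`-extension. As the old order is an admissible reordering of the new one, a single implication
about depth-optimality suffices.

Depth-optimality is replaced by a freeness property in any difference field `E` that contains `F`
and has all its constants in `G`. Let `N₀ = G`, and let `N_{d+1}` be generated by `N_d`, the `tⱼ` of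
depth at most `d + 1`, and all `g` in `E` with `σ g - g ∈ N_d` (`filt`). Freeness (`IsFree`) means
that every `tⱼ` of depth larger than `d` is transcendental over `N_d(t₁, …, tⱼ₋₁)`.
`IsPiSigmaDelta.isFree` derives it by induction on the number of generators. If the new generator is
a sum, the `N_d` do not change. Were it algebraic, it would lie in `N_d(t₁, …, tⱼ₋₁)`; finitely many
sums are responsible for this, and `exists_isSumTower_of_mem_sup` arranges them into a
`Σ*`-extension of depth at most `d`, against depth-optimality. If the new generator is a product,
the `N_d` grow, since there are more sums over them. `IsFree.succ_of_prod` shows by induction on `d`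
that the larger `N_d` stays independent from all iterated sums over the earlier generators
(`Indep.layer`). The crux is that a solution of a difference equation descends through the tower
(`Descends`).

Now let a `Σ*`-extension refute the depth-optimality of a sum `tᵢ` in the reordered tower.
`IsSigmaStarOver.hasAmalgam` embeds it and `F` into one difference field with constants in `G`.
There its solution `g` lies in the field generated by `N_D` and the generators other than `tᵢ`,
where `D + 1` is the depth of `tᵢ`, and `g - tᵢ` is constant. So `tᵢ` lies in that field, although
by freeness and exchange (`transcendental_sup_compl`) it is transcendental over it. -/

namespace DiffField

open Polynomial IntermediateField

/-! ### Simple transcendental extensions: exchange, and splitting into polynomial and proper parts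
-/

section Simple

variable {G : Type u} [Field G] {E : Type v} [Field E] [Algebra G E]

/-- The polynomials over `E` with coefficients in the intermediate field `M`. -/
noncomputable def polys (M : IntermediateField G E) : Subring E[X] :=
  liftsRing (algebraMap M E)

theorem mem_polys {M : IntermediateField G E} {P : E[X]} :
    P ∈ polys M ↔ ∀ n, P.coeff n ∈ M := by
  change P ∈ lifts (algebraMap M E) ↔ _
  rw [lifts_iff_coeff_lifts]
  refine forall_congr' fun n => ?_
  constructor
  · rintro ⟨y, hy⟩
    rw [← hy]
    exact y.2
  · intro h
    exact ⟨⟨_, h⟩, rfl⟩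

theorem exists_map_of_mem_polys {M : IntermediateField G E} {P : E[X]} (h : P ∈ polys M) :
    ∃ Q : M[X], Q.map (algebraMap M E) = P :=
  (mem_lifts P).1 h

theorem map_mem_polys {M : IntermediateField G E} (Q : M[X]) :
    Q.map (algebraMap M E) ∈ polys M :=
  (mem_lifts _).2 ⟨Q, rfl⟩

theorem C_mem_polys {M : IntermediateField G E} {c : E} (h : c ∈ M) : C c ∈ polys M := by
  rw [mem_polys]
  intro n
  rw [coeff_C]
  split_ifs
  exacts [h, zero_mem M]

theorem X_mem_polys {M : IntermediateField G E} : (X : E[X]) ∈ polys M := by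
  rw [mem_polys]
  intro n
  rw [coeff_X]
  split_ifs
  exacts [one_mem M, zero_mem M]

theorem polys_mono {M N : IntermediateField G E} (h : M ≤ N) : polys M ≤ polys N := by
  intro P hP
  rw [mem_polys] at hP ⊢
  exact fun n => h (hP n)

theorem transcendental_iff_polys {M : IntermediateField G E} {x : E} :
    Transcendental M x ↔ ∀ P ∈ polys M, P.eval x = 0 → P = 0 := by
  rw [transcendental_iff]
  constructor
  · intro h P hP h0
    obtain ⟨Q, rfl⟩ := exists_map_of_mem_polys hP
    rw [eval_map_algebraMap] at h0
    rw [h Q h0, Polynomial.map_zero]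
  · intro h Q hQ
    have := h _ (map_mem_polys Q) (by rwa [eval_map_algebraMap])
    exact (Polynomial.map_eq_zero _).1 this

theorem transcendental_mono {M N : IntermediateField G E} (h : M ≤ N) {x : E}
    (hx : Transcendental N x) : Transcendental M x := by
  rw [transcendental_iff_polys] at hx ⊢
  exact fun P hP => hx P (polys_mono h hP)

theorem notMem_of_transcendental {M : IntermediateField G E} {x : E}
    (hx : Transcendental M x) : x ∉ M := by
  intro h
  exact hx (isAlgebraic_algebraMap (⟨x, h⟩ : M))

theorem mem_sup_simple {M : IntermediateField G E} {x z : E} :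
    z ∈ M ⊔ G⟮x⟯ ↔ ∃ P ∈ polys M, ∃ Q ∈ polys M, z = P.eval x / Q.eval x := by
  rw [← restrictScalars_adjoin_eq_sup, mem_restrictScalars, mem_adjoin_simple_iff]
  constructor
  · rintro ⟨r, s, rfl⟩
    exact ⟨_, map_mem_polys r, _, map_mem_polys s, by simp [eval_map_algebraMap]⟩
  · rintro ⟨P, hP, Q, hQ, rfl⟩
    obtain ⟨P, rfl⟩ := exists_map_of_mem_polys hP
    obtain ⟨Q, rfl⟩ := exists_map_of_mem_polys hQ
    exact ⟨P, Q, by simp [eval_map_algebraMap]⟩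

theorem mem_sup_simple' {M : IntermediateField G E} {x z : E} (h : z ∈ M ⊔ G⟮x⟯) :
    ∃ P ∈ polys M, ∃ Q ∈ polys M, Q.eval x ≠ 0 ∧ z = P.eval x / Q.eval x := by
  obtain ⟨P, hP, Q, hQ, rfl⟩ := mem_sup_simple.1 h
  by_cases h0 : Q.eval x = 0
  · exact ⟨0, zero_mem _, 1, one_mem _, by simp, by simp [h0]⟩
  · exact ⟨P, hP, Q, hQ, h0, rfl⟩

theorem eval_mem_sup_simple {M : IntermediateField G E} {P : E[X]} (hP : P ∈ polys M) (x : E) :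
    P.eval x ∈ M ⊔ G⟮x⟯ :=
  mem_sup_simple.2 ⟨P, hP, 1, one_mem _, by simp⟩

theorem self_mem_sup_simple (M : IntermediateField G E) (x : E) : x ∈ M ⊔ G⟮x⟯ :=
  (le_sup_right : G⟮x⟯ ≤ _) (mem_adjoin_simple_self G x)

theorem sup_simple_eq_of_mem {M : IntermediateField G E} {x : E} (h : x ∈ M) : M ⊔ G⟮x⟯ = M :=
  sup_eq_left.2 (adjoin_simple_le_iff.2 h)

/-- Clearing denominators in `z = P(x)/Q(x)` gives a relation for `x` over `N`, which must vanish
coefficientwise. A nonzero coefficient of `Q` then exhibits `z` as a quotient of elements of `M`. -/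
theorem mem_of_transcendental {M N : IntermediateField G E} (h : M ≤ N) {x z : E}
    (hx : Transcendental N x) (hz : z ∈ N) (hzx : z ∈ M ⊔ G⟮x⟯) : z ∈ M := by
  obtain ⟨P, hP, Q, hQ, h0, e⟩ := mem_sup_simple' hzx
  rw [transcendental_iff_polys] at hx
  have h1 : C z * Q - P = 0 := by
    refine hx _ (sub_mem (mul_mem (C_mem_polys hz) (polys_mono h hQ)) (polys_mono h hP)) ?_
    rw [eq_div_iff h0] at e
    simp [e]
  have hQ0 : Q ≠ 0 := by
    rintro rfl
    simp at h0
  obtain ⟨n, hn⟩ : ∃ n, Q.coeff n ≠ 0 := ⟨_, mt leadingCoeff_eq_zero.1 hQ0⟩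
  have h2 : z * Q.coeff n = P.coeff n := by
    have := congrArg (fun R : E[X] => R.coeff n) h1
    simpa [sub_eq_zero] using this
  rw [← eq_div_iff hn] at h2
  rw [h2]
  exact div_mem (mem_polys.1 hP n) (mem_polys.1 hQ n)

theorem transcendental_sup_iff {M : IntermediateField G E} {S : Set E} {x : E} :
    Transcendental (M ⊔ adjoin G S : IntermediateField G E) x ↔
      Transcendental (Algebra.adjoin M S) x := by
  rw [← transcendental_adjoin_iff, ← restrictScalars_adjoin_eq_sup]
  rfl

/-- Algebraic independence of the pair does not depend on its order. -/
theorem transcendental_exchange {M : IntermediateField G E} {x y : E}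
    (hx : Transcendental M x) (hy : Transcendental (M ⊔ G⟮x⟯ : IntermediateField G E) y) :
    Transcendental (M ⊔ G⟮y⟯ : IntermediateField G E) x := by
  have hxy : x ∉ ({y} : Set E) := by
    rintro rfl
    exact notMem_of_transcendental hy (self_mem_sup_simple M _)
  have hyx : y ∉ ({x} : Set E) := fun h => hxy (Set.mem_singleton_iff.2 (Set.mem_singleton_iff.1 h).symm)
  have h1 : AlgebraicIndepOn M id ({x} : Set E) := by
    rw [AlgebraicIndepOn, algebraicIndependent_singleton_iff ⟨x, rfl⟩]
    exact hx
  have h2 : AlgebraicIndepOn M id (insert y ({x} : Set E)) := by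
    refine h1.insert ?_
    rw [transcendental_sup_iff] at hy
    rwa [Set.image_id]
  rw [Set.pair_comm, AlgebraicIndepOn.insert_iff hxy] at h2
  rw [transcendental_sup_iff]
  have h3 := h2.2
  rwa [Set.image_id] at h3

/-- The values at `x` of the fractions over `M` whose numerator has smaller degree than the
denominator. -/
def IsProper (M : IntermediateField G E) (x w : E) : Prop :=
  ∃ R ∈ polys M, ∃ Q ∈ polys M, Q ≠ 0 ∧ R.degree < Q.degree ∧ w = R.eval x / Q.eval x

theorem IsProper.mono {M N : IntermediateField G E} (h : M ≤ N) {x w : E}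
    (hw : IsProper M x w) : IsProper N x w := by
  obtain ⟨R, hR, Q, hQ, h1, h2, h3⟩ := hw
  exact ⟨R, polys_mono h hR, Q, polys_mono h hQ, h1, h2, h3⟩

theorem eval_ne_zero {M : IntermediateField G E} {x : E} (hx : Transcendental M x) {Q : E[X]}
    (hQ : Q ∈ polys M) (h : Q ≠ 0) : Q.eval x ≠ 0 :=
  fun h0 => h (transcendental_iff_polys.1 hx Q hQ h0)

theorem IsProper.sub {M : IntermediateField G E} {x v w : E} (hx : Transcendental M x)
    (hv : IsProper M x v) (hw : IsProper M x w) : IsProper M x (v - w) := by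
  obtain ⟨R, hR, Q, hQ, h1, h2, rfl⟩ := hv
  obtain ⟨S, hS, T, hT, k1, k2, rfl⟩ := hw
  refine ⟨R * T - Q * S, sub_mem (mul_mem hR hT) (mul_mem hQ hS), Q * T, mul_mem hQ hT,
    mul_ne_zero h1 k1, ?_, ?_⟩
  · refine (degree_sub_le _ _).trans_lt (max_lt ?_ ?_)
    · rw [degree_mul, degree_mul]
      exact WithBot.add_lt_add_right (degree_ne_bot.2 k1) h2
    · rw [degree_mul, degree_mul]
      exact WithBot.add_lt_add_left (degree_ne_bot.2 h1) k2
  · rw [eval_sub, eval_mul, eval_mul, eval_mul,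
      div_sub_div _ _ (eval_ne_zero hx hQ h1) (eval_ne_zero hx hT k1)]

/-- Division with remainder of the numerator by the denominator. -/
theorem exists_poly_add_proper {M : IntermediateField G E} {x z : E}
    (hz : z ∈ M ⊔ G⟮x⟯) : ∃ A ∈ polys M, ∃ w, IsProper M x w ∧ z = A.eval x + w := by
  obtain ⟨P, hP, Q, hQ, h0, rfl⟩ := mem_sup_simple' hz
  obtain ⟨P, rfl⟩ := exists_map_of_mem_polys hP
  obtain ⟨Q, rfl⟩ := exists_map_of_mem_polys hQ
  have hQ0 : Q ≠ 0 := by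
    rintro rfl
    simp at h0
  have hQ1 : Q.map (algebraMap M E) ≠ 0 := (Polynomial.map_ne_zero_iff (algebraMap M E).injective).2 hQ0
  refine ⟨_, map_mem_polys (P / Q), _, ⟨_, map_mem_polys (P % Q), _, map_mem_polys Q, hQ1, ?_, rfl⟩, ?_⟩
  · rw [degree_map, degree_map]
    exact EuclideanDomain.mod_lt P hQ0
  · conv_lhs => rw [← EuclideanDomain.div_add_mod P Q]
    rw [Polynomial.map_add, Polynomial.map_mul, eval_add, eval_mul]
    field_simp

/-- This is the uniqueness of the splitting: for transcendental `x` the equality lifts to `A * Q =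
R`, which the degrees forbid for `A ≠ 0`. -/
theorem eq_zero_of_poly_eq_proper {M : IntermediateField G E} {x w : E} (hx : Transcendental M x)
    (hw : IsProper M x w) {A : E[X]} (hA : A ∈ polys M) (h : A.eval x = w) : A = 0 := by
  obtain ⟨R, hR, Q, hQ, h1, h2, rfl⟩ := hw
  rw [eq_div_iff (eval_ne_zero hx hQ h1)] at h
  have h3 : A * Q - R = 0 := transcendental_iff_polys.1 hx _ (sub_mem (mul_mem hA hQ) hR) (by simp [h])
  by_contra hA0
  rw [sub_eq_zero] at h3
  rw [← h3, degree_mul] at h2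
  have h4 : Q.degree ≤ A.degree + Q.degree :=
    le_add_of_nonneg_left (zero_le_degree_iff.2 hA0)
  exact absurd h2 (not_lt.2 h4)

end Simple

/-! ### Difference equations in one sum or product over a difference field -/

section Twist

variable {G : Type u} [Field G] {E : Type v} [Field E] [Algebra G E]

/-- The subfield `M` is mapped into itself by `σ`. -/
def Stable (σ : E ≃+* E) (M : IntermediateField G E) : Prop := ∀ x ∈ M, σ x ∈ M

/-- The action on polynomials that corresponds to `σ` with `σ x = α x + β`. -/
noncomputable def twist (σ : E ≃+* E) (α β : E) (A : E[X]) : E[X] :=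
  (A.map (σ : E →+* E)).comp (C α * X + C β)

theorem eval_twist {σ : E ≃+* E} {α β x : E} (hx : σ x = α * x + β) (A : E[X]) :
    (twist σ α β A).eval x = σ (A.eval x) := by
  rw [twist, eval_comp, eval_add, eval_mul, eval_C, eval_X, eval_C, ← hx]
  change (A.map (σ : E →+* E)).eval ((σ : E →+* E) x) = _
  rw [eval_map_apply]
  rfl

theorem map_mem_polys_of_stable {σ : E ≃+* E} {M : IntermediateField G E} (hM : Stable σ M)
    {A : E[X]} (hA : A ∈ polys M) : A.map (σ : E →+* E) ∈ polys M := by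
  rw [mem_polys] at hA ⊢
  intro n
  rw [coeff_map]
  exact hM _ (hA n)

theorem comp_mem_polys {M : IntermediateField G E} {A B : E[X]} (hA : A ∈ polys M)
    (hB : B ∈ polys M) : A.comp B ∈ polys M := by
  obtain ⟨A, rfl⟩ := exists_map_of_mem_polys hA
  obtain ⟨B, rfl⟩ := exists_map_of_mem_polys hB
  rw [← Polynomial.map_comp]
  exact map_mem_polys _

theorem twist_mem_polys {σ : E ≃+* E} {M : IntermediateField G E} (hM : Stable σ M) {α β : E}
    (hα : α ∈ M) (hβ : β ∈ M) {A : E[X]} (hA : A ∈ polys M) : twist σ α β A ∈ polys M :=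
  comp_mem_polys (map_mem_polys_of_stable hM hA)
    (add_mem (mul_mem (C_mem_polys hα) X_mem_polys) (C_mem_polys hβ))

theorem degree_twist (σ : E ≃+* E) {α β : E} (hα : α ≠ 0) (A : E[X]) :
    (twist σ α β A).degree = A.degree := by
  by_cases hA : A = 0
  · simp [hA, twist]
  have h1 : (C α * X + C β).natDegree = 1 := natDegree_linear hα
  have h2 : A.map (σ : E →+* E) ≠ 0 := (Polynomial.map_ne_zero_iff σ.injective).2 hA
  have h3 : twist σ α β A ≠ 0 := by
    rw [twist, Ne, comp_eq_zero_iff]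
    rintro (h | ⟨-, h⟩)
    · exact h2 h
    · rw [h, natDegree_C] at h1
      exact zero_ne_one h1
  rw [degree_eq_natDegree h3, degree_eq_natDegree hA, twist, natDegree_comp, h1, mul_one,
    natDegree_map_eq_of_injective σ.injective]

theorem IsProper.map {σ : E ≃+* E} {M : IntermediateField G E} (hM : Stable σ M) {α β x : E}
    (hα0 : α ≠ 0) (hα : α ∈ M) (hβ : β ∈ M) (hx : σ x = α * x + β) {w : E}
    (hw : IsProper M x w) : IsProper M x (σ w) := by
  obtain ⟨R, hR, Q, hQ, h1, h2, rfl⟩ := hw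
  refine ⟨_, twist_mem_polys hM hα hβ hR, _, twist_mem_polys hM hα hβ hQ, ?_, ?_, ?_⟩
  · rw [← degree_ne_bot, degree_twist σ hα0, degree_ne_bot]
    exact h1
  · rwa [degree_twist σ hα0, degree_twist σ hα0]
  · rw [eval_twist hx, eval_twist hx, map_div₀]

/-- Both `z` and `σ z - z - n` are split into polynomial and proper part, the latter over the
smaller field `M`. The splittings can be compared over `N`, where they are unique, so the polynomial
equation has its right side over `M`. -/
theorem exists_poly_of_sub_mem_sup {σ : E ≃+* E} {M N : IntermediateField G E} (hMN : M ≤ N)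
    (hN : Stable σ N) {α β x : E} (hα0 : α ≠ 0) (hα : α ∈ N) (hβ : β ∈ N) (hx : σ x = α * x + β)
    (ht : Transcendental N x) {z n : E} (hz : z ∈ N ⊔ G⟮x⟯) (hn : n ∈ N)
    (h : σ z - z - n ∈ M ⊔ G⟮x⟯) :
    ∃ A ∈ polys N, ∃ B ∈ polys M, ∃ w, IsProper N x w ∧ z = A.eval x + w ∧
      IsProper M x (σ w - w) ∧ twist σ α β A - A - C n = B := by
  obtain ⟨A, hA, w, hw, rfl⟩ := exists_poly_add_proper hz
  obtain ⟨B, hB, v, hv, e⟩ := exists_poly_add_proper h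
  have hp : IsProper N x (v - (σ w - w)) :=
    (hv.mono hMN).sub ht ((hw.map hN hα0 hα hβ hx).sub ht hw)
  have hA' : twist σ α β A - A - C n - B ∈ polys N :=
    sub_mem (sub_mem (sub_mem (twist_mem_polys hN hα hβ hA) hA) (C_mem_polys hn))
      (polys_mono hMN hB)
  have e2 : (twist σ α β A - A - C n - B).eval x = v - (σ w - w) := by
    rw [eval_sub, eval_sub, eval_sub, eval_twist hx, eval_C]
    rw [map_add] at e
    linear_combination e
  have h0 := eq_zero_of_poly_eq_proper ht hp hA' e2
  refine ⟨A, hA, B, hB, w, hw, rfl, ?_, sub_eq_zero.1 h0⟩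
  rw [h0, eval_zero, eq_comm, sub_eq_zero] at e2
  rwa [← e2]

/-- The proper part of `z` turns out to be constant, hence in `M`, and a proper element of `M` is
zero. -/
theorem exists_poly_of_sub_mem {σ : E ≃+* E} {M : IntermediateField G E} (hM : Stable σ M)
    (hc : ∀ c, σ c = c → c ∈ M) {α β x : E} (hα0 : α ≠ 0) (hα : α ∈ M) (hβ : β ∈ M)
    (hx : σ x = α * x + β) (ht : Transcendental M x) {z : E} (hz : z ∈ M ⊔ G⟮x⟯)
    (h : σ z - z ∈ M) :
    ∃ A ∈ polys M, z = A.eval x ∧ twist σ α β A - A = C (σ z - z) := by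
  obtain ⟨A, hA, w, hw, rfl⟩ := exists_poly_add_proper hz
  set m := σ (A.eval x + w) - (A.eval x + w) with hm
  have e2 : (twist σ α β A - A - C m).eval x = w - σ w := by
    rw [eval_sub, eval_sub, eval_twist hx, eval_C, hm, map_add]
    ring
  have h0 := eq_zero_of_poly_eq_proper ht (hw.sub ht (hw.map hM hα0 hα hβ hx))
    (sub_mem (sub_mem (twist_mem_polys hM hα hβ hA) hA) (C_mem_polys h)) e2
  rw [h0, eval_zero, eq_comm, sub_eq_zero] at e2
  have hwM : w ∈ M := hc w e2.symm
  have hw0 : w = 0 := by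
    have := eq_zero_of_poly_eq_proper ht hw (C_mem_polys hwM) (eval_C)
    simpa using this
  exact ⟨A, hA, by rw [hw0, add_zero], sub_eq_zero.1 h0⟩

/-- Taylor expansion: the `n`-th Hasse derivative is linear, so only two terms remain. -/
theorem coeff_comp_X_add_C_of_natDegree_le {f : E[X]} {n : ℕ} (h : f.natDegree ≤ n + 1) (r : E) :
    (f.comp (X + C r)).coeff n = f.coeff n + (n + 1) * f.coeff (n + 1) * r := by
  rw [← taylor_apply, taylor_coeff]
  have h1 : (hasseDeriv n f).natDegree < 2 := by
    have := natDegree_hasseDeriv_le f n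
    omega
  rw [eval_eq_sum_range' h1, Finset.sum_range_succ, Finset.sum_range_one, hasseDeriv_coeff,
    hasseDeriv_coeff]
  simp [add_comm 1 n]

theorem coeff_twist_one {σ : E ≃+* E} {β : E} {f : E[X]} {n : ℕ} (h : f.natDegree ≤ n + 1) :
    (twist σ 1 β f).coeff n = σ (f.coeff n) + (n + 1) * σ (f.coeff (n + 1)) * β := by
  rw [twist, C_1, one_mul, coeff_comp_X_add_C_of_natDegree_le]
  · simp
  · exact natDegree_map_le.trans h

theorem coeff_twist_zero {σ : E ≃+* E} {α : E} (f : E[X]) (n : ℕ) :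
    (twist σ α 0 f).coeff n = σ (f.coeff n) * α ^ n := by
  rw [twist, C_0, add_zero, comp_C_mul_X_coeff]
  simp

theorem twist_sub (σ : E ≃+* E) (α β : E) (A B : E[X]) :
    twist σ α β (A - B) = twist σ α β A - twist σ α β B := by
  rw [twist, Polynomial.map_sub, sub_comp]
  rfl

section CharZero

variable [CharZero E]

/-- A sum over `M` which is not in `M` is transcendental over `M`. -/
theorem transcendental_of_sum {σ : E ≃+* E} {M : IntermediateField G E} (hM : Stable σ M)
    (hc : ∀ c, σ c = c → c ∈ M) {s : E} (hs : σ s - s ∈ M) (hsM : s ∉ M) :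
    Transcendental M s := by
  intro halg
  have hint : IsIntegral M s := halg.isIntegral
  set b := σ s - s with hb
  have hsb : σ s = 1 * s + b := by rw [hb]; ring
  set p := minpoly M s with hp
  set P := p.map (algebraMap M E) with hP
  have hPM : P ∈ polys M := map_mem_polys p
  have hPm : P.Monic := (minpoly.monic hint).map _
  have hP0 : P.eval s = 0 := by
    rw [hP, eval_map_algebraMap, minpoly.aeval]
  obtain ⟨n, hn⟩ : ∃ n, P.natDegree = n + 1 := by
    refine ⟨P.natDegree - 1, ?_⟩
    have : 0 < p.natDegree := minpoly.natDegree_pos hint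
    rw [hP, natDegree_map]
    omega
  -- This difference vanishes at `s` and the leading terms cancel, so minimality of `P` forces it to
  -- be zero.
  have hD : twist σ 1 b P - P = 0 := by
    obtain ⟨D, hD⟩ := exists_map_of_mem_polys (sub_mem (twist_mem_polys hM (one_mem M) hs hPM) hPM)
    have h1 : (twist σ 1 b P - P).eval s = 0 := by
      rw [eval_sub, eval_twist hsb, hP0, map_zero, sub_zero]
    by_contra h2
    have hD0 : D ≠ 0 := by
      rintro rfl
      exact h2 (by rw [← hD, Polynomial.map_zero])
    rw [← hD, eval_map_algebraMap] at h1
    have h3 := minpoly.degree_le_of_ne_zero M s hD0 h1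
    have hdeg : (twist σ 1 b P).degree = P.degree := degree_twist σ one_ne_zero P
    have hPne : P ≠ 0 := hPm.ne_zero
    have hlead : (twist σ 1 b P).leadingCoeff = P.leadingCoeff := by
      have e1 : (twist σ 1 b P).natDegree = n + 1 := by
        rw [← hn]
        exact natDegree_eq_of_degree_eq hdeg
      rw [leadingCoeff, leadingCoeff, e1, hn, coeff_twist_one (by omega),
        coeff_eq_zero_of_natDegree_lt (by omega : P.natDegree < n + 1 + 1)]
      have : P.coeff (n + 1) = 1 := by
        rw [← hn]
        exact hPm
      simp [this]
    have h4 := degree_sub_lt_left hdeg (by rw [← degree_ne_bot, hdeg, degree_ne_bot]; exact hPne) hlead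
    rw [← hD, degree_map, hdeg, hP, degree_map] at h4
    exact absurd h3 (not_le.2 h4)
  have hco := congrArg (fun R : E[X] => R.coeff n) hD
  simp only [coeff_sub, coeff_zero] at hco
  rw [coeff_twist_one hn.le] at hco
  have hl : P.coeff (n + 1) = 1 := by
    rw [← hn]
    exact hPm
  rw [hl, map_one, mul_one] at hco
  have hn0 : ((n : E) + 1) ≠ 0 := Nat.cast_add_one_ne_zero n
  -- The second highest coefficient of the identity says that this element is constant; dividing by
  -- `n + 1` needs characteristic zero.
  have hmem : s + P.coeff n / (n + 1) ∈ M := by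
    apply hc
    rw [map_add, map_div₀, map_add, map_natCast, map_one, hsb]
    field_simp
    linear_combination hco
  have : P.coeff n / (n + 1) ∈ M :=
    div_mem (mem_polys.1 hPM n) (add_mem (IntermediateField.natCast_mem M n) (one_mem M))
  exact hsM (by simpa using sub_mem hmem this)

/-- A polynomial solution is linear: if its degree were `k ≥ 2` with top coefficients `u`, `v`, then
`u` would be constant and so would `x + v / (k u)`, which puts `x` into `M`. -/
theorem exists_linear_of_sum {σ : E ≃+* E} {M : IntermediateField G E} (hM : Stable σ M)
    (hc : ∀ c, σ c = c → c ∈ M) {x : E} (hx : σ x - x ∈ M) (ht : Transcendental M x) {z : E}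
    (hz : z ∈ M ⊔ G⟮x⟯) (h : σ z - z ∈ M) :
    ∃ c w, σ c = c ∧ w ∈ M ∧ z = c * x + w := by
  set b := σ x - x with hb
  have hxb : σ x = 1 * x + b := by rw [hb]; ring
  obtain ⟨A, hA, rfl, e⟩ :=
    exists_poly_of_sub_mem hM hc one_ne_zero (one_mem M) hx hxb ht hz h
  have hdeg : A.natDegree ≤ 1 := by
    by_contra! hlt
    obtain ⟨n, hn⟩ : ∃ n, A.natDegree = n + 1 + 1 := ⟨A.natDegree - 2, by omega⟩
    have e1 := congrArg (fun R : E[X] => R.coeff (n + 1)) e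
    have e2 := congrArg (fun R : E[X] => R.coeff (n + 1 + 1)) e
    simp only [coeff_sub] at e1 e2
    rw [coeff_twist_one hn.le, coeff_C_of_ne_zero (by omega)] at e1
    rw [coeff_twist_one (by omega), coeff_C_of_ne_zero (by omega),
      coeff_eq_zero_of_natDegree_lt (by omega : A.natDegree < n + 1 + 1 + 1)] at e2
    rw [map_zero, mul_zero, zero_mul, add_zero, sub_eq_zero] at e2
    have hl : A.coeff (n + 1 + 1) ≠ 0 := by
      rw [← hn]
      exact leadingCoeff_ne_zero.2 (by rintro rfl; simp at hn)
    have hn0 : ((n : E) + 1 + 1) ≠ 0 := by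
      have := Nat.cast_add_one_ne_zero (R := E) (n + 1)
      rwa [Nat.cast_add, Nat.cast_one] at this
    rw [e2, Nat.cast_add, Nat.cast_one] at e1
    have hmem : x + A.coeff (n + 1) / ((n + 1 + 1) * A.coeff (n + 1 + 1)) ∈ M := by
      apply hc
      rw [map_add, map_div₀, map_mul, map_add, map_add, map_natCast, map_one, hxb, e2]
      field_simp
      linear_combination e1
    have : A.coeff (n + 1) / ((n + 1 + 1) * A.coeff (n + 1 + 1)) ∈ M :=
      div_mem (mem_polys.1 hA _) (mul_mem (add_mem (add_mem (IntermediateField.natCast_mem M n) (one_mem M))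
        (one_mem M)) (mem_polys.1 hA _))
    exact notMem_of_transcendental ht (by simpa using sub_mem hmem this)
  refine ⟨A.coeff 1, A.coeff 0, ?_, mem_polys.1 hA 0, ?_⟩
  · have e1 := congrArg (fun R : E[X] => R.coeff 1) e
    simp only [coeff_sub] at e1
    rw [coeff_twist_one (by omega), coeff_C_of_ne_zero one_ne_zero,
      coeff_eq_zero_of_natDegree_lt (by omega : A.natDegree < 1 + 1)] at e1
    rwa [map_zero, mul_zero, zero_mul, add_zero, sub_eq_zero] at e1
  · conv_lhs => rw [eq_X_add_C_of_natDegree_le_one hdeg]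
    simp

end CharZero

/-- A nonzero coefficient `c` of degree `n > 0` in a polynomial solution satisfies `σ c * α ^ n =
c`. Then `c * x ^ n` is constant, hence in `M`, against transcendence of `x`. -/
theorem mem_of_sum_of_prod {σ : E ≃+* E} {M : IntermediateField G E} (hM : Stable σ M)
    (hc : ∀ c, σ c = c → c ∈ M) {α x : E} (hα0 : α ≠ 0) (hα : α ∈ M) (hx : σ x = α * x)
    (ht : Transcendental M x) {z : E} (hz : z ∈ M ⊔ G⟮x⟯) (h : σ z - z ∈ M) : z ∈ M := by
  obtain ⟨A, hA, rfl, e⟩ :=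
    exists_poly_of_sub_mem hM hc hα0 hα (zero_mem M) (by rw [hx, add_zero]) ht hz h
  have hA0 : A = C (A.coeff 0) := by
    ext n
    rcases Nat.eq_zero_or_pos n with rfl | hn
    · simp
    rw [coeff_C_of_ne_zero hn.ne']
    by_contra hne
    have e1 := congrArg (fun R : E[X] => R.coeff n) e
    simp only [coeff_sub] at e1
    rw [coeff_twist_zero, coeff_C_of_ne_zero hn.ne', sub_eq_zero] at e1
    have h1 : A.coeff n * x ^ n ∈ M := by
      apply hc
      rw [map_mul, map_pow, hx, mul_pow]
      linear_combination x ^ n * e1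
    have h2 : C (A.coeff n) * X ^ n - C (A.coeff n * x ^ n) = 0 := by
      refine transcendental_iff_polys.1 ht _ (sub_mem (mul_mem (C_mem_polys (mem_polys.1 hA n))
        (pow_mem X_mem_polys n)) (C_mem_polys h1)) ?_
      simp
    have := congrArg (fun R : E[X] => R.coeff n) h2
    simp only [coeff_sub, coeff_C_mul_X_pow, coeff_zero, if_true] at this
    rw [coeff_C_of_ne_zero hn.ne', sub_zero] at this
    exact hne this
  rw [hA0, eval_C]
  exact mem_polys.1 hA 0

/-- A product over `M` stays transcendental after adjoining a sum over `M`. -/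
theorem transcendental_prod_of_sum [CharZero E] {σ : E ≃+* E} {M : IntermediateField G E}
    (hM : Stable σ M) (hc : ∀ c, σ c = c → c ∈ M) {α y : E} (hα0 : α ≠ 0) (hα : α ∈ M)
    (hy : σ y = α * y) (ht : Transcendental M y) (hMy : Stable σ (M ⊔ G⟮y⟯)) {s : E}
    (hs : σ s - s ∈ M) : Transcendental (M ⊔ G⟮s⟯ : IntermediateField G E) y := by
  by_cases hsM : s ∈ M
  · rwa [sup_simple_eq_of_mem hsM]
  -- By exchange it suffices that `s` is transcendental over `M(y)`. Otherwise it would lie in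
  -- `M(y)`, and then in `M`.
  refine transcendental_exchange ht ?_
  refine transcendental_of_sum hMy (fun c h => (le_sup_left : M ≤ _) (hc c h))
    ((le_sup_left : M ≤ _) hs) ?_
  intro h
  exact hsM (mem_of_sum_of_prod hM hc hα0 hα hy ht h hs)

/-- For a product the twist acts on each coefficient separately, so the constant terms alone satisfy
the equation. -/
theorem exists_sub_mem_of_prod {σ : E ≃+* E} {M N : IntermediateField G E} (hMN : M ≤ N)
    (hN : Stable σ N) {α x : E} (hα0 : α ≠ 0) (hα : α ∈ N) (hx : σ x = α * x)
    (ht : Transcendental N x) {z n : E} (hz : z ∈ N ⊔ G⟮x⟯) (hn : n ∈ N)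
    (h : σ z - z - n ∈ M ⊔ G⟮x⟯) : ∃ a ∈ N, σ a - a - n ∈ M := by
  obtain ⟨A, hA, B, hB, w, -, -, -, e⟩ :=
    exists_poly_of_sub_mem_sup hMN hN hα0 hα (zero_mem N) (by rw [hx, add_zero]) ht hz hn h
  refine ⟨A.coeff 0, mem_polys.1 hA 0, ?_⟩
  have e1 := congrArg (fun R : E[X] => R.coeff 0) e
  simp only [coeff_sub, coeff_twist_zero, pow_zero, mul_one, coeff_C_zero] at e1
  rw [e1]
  exact mem_polys.1 hB 0

/-- Induction from the top: the leading coefficient `u` has `σ u - u ∈ M`, hence lies in `M`, and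
its monomial can be subtracted without leaving the hypotheses. -/
theorem coeff_mem_of_twist_sub {σ : E ≃+* E} {M N : IntermediateField G E}
    (hM : Stable σ M) {β : E} (hβ : β ∈ M) (hsum : ∀ u ∈ N, σ u - u ∈ M → u ∈ M) :
    ∀ (n : ℕ) (A : E[X]), A ∈ polys N → A.natDegree ≤ n →
      (∀ j, 1 ≤ j → (twist σ 1 β A - A).coeff j ∈ M) → ∀ j, 1 ≤ j → A.coeff j ∈ M := by
  intro n
  induction n with
  | zero =>
    intro A _ hd _ j hj
    rw [coeff_eq_zero_of_natDegree_lt (by omega)]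
    exact zero_mem M
  | succ n ih =>
    intro A hA hd h j hj
    have hu : A.coeff (n + 1) ∈ M := by
      refine hsum _ (mem_polys.1 hA _) ?_
      have := h (n + 1) (by omega)
      rw [coeff_sub, coeff_twist_one (by omega),
        coeff_eq_zero_of_natDegree_lt (by omega : A.natDegree < n + 1 + 1)] at this
      simpa using this
    have hmon : C (A.coeff (n + 1)) * X ^ (n + 1) ∈ polys M :=
      mul_mem (C_mem_polys hu) (pow_mem X_mem_polys _)
    set A' := A - C (A.coeff (n + 1)) * X ^ (n + 1) with hA'
    have hd' : A'.natDegree ≤ n := by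
      rw [natDegree_le_iff_coeff_eq_zero]
      intro k hk
      rw [hA', coeff_sub, coeff_C_mul_X_pow]
      split_ifs with hkn
      · rw [hkn, sub_self]
      · rw [coeff_eq_zero_of_natDegree_lt (by omega), sub_zero]
    have key : ∀ j, 1 ≤ j → A'.coeff j ∈ M := by
      refine ih A' ?_ hd' ?_
      · rw [mem_polys]
        intro k
        rw [hA', coeff_sub, coeff_C_mul_X_pow]
        refine sub_mem (mem_polys.1 hA k) ?_
        split_ifs
        exacts [mem_polys.1 hA _, zero_mem N]
      · intro k hk
        have e : twist σ 1 β A' - A' = (twist σ 1 β A - A) -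
            (twist σ 1 β (C (A.coeff (n + 1)) * X ^ (n + 1)) - C (A.coeff (n + 1)) * X ^ (n + 1)) := by
          rw [hA', twist_sub]
          ring
        rw [e, coeff_sub]
        exact sub_mem (h k hk) (mem_polys.1
          (sub_mem (twist_mem_polys hM (one_mem M) hβ hmon) hmon) k)
    have : A.coeff j = A'.coeff j + (C (A.coeff (n + 1)) * X ^ (n + 1)).coeff j := by
      rw [hA', coeff_sub, sub_add_cancel]
    rw [this]
    exact add_mem (key j hj) (mem_polys.1 hmon j)

/-- For a sum the constant term of the twist also receives contributions from higher coefficients.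
These lie in `M` by `coeff_mem_of_twist_sub`, so the nonconstant part of the solution can be dropped
modulo `M`. -/
theorem exists_sub_mem_of_sum {σ : E ≃+* E} {M N : IntermediateField G E} (hMN : M ≤ N)
    (hM : Stable σ M) (hN : Stable σ N) {x : E} (hx : σ x - x ∈ M)
    (ht : Transcendental N x) (hsum : ∀ u ∈ N, σ u - u ∈ M → u ∈ M) {z n : E}
    (hz : z ∈ N ⊔ G⟮x⟯) (hn : n ∈ N) (h : σ z - z - n ∈ M ⊔ G⟮x⟯) :
    ∃ a ∈ N, σ a - a - n ∈ M := by
  set β := σ x - x with hβ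
  have hxb : σ x = 1 * x + β := by rw [hβ]; ring
  obtain ⟨A, hA, B, hB, w, -, -, -, e⟩ :=
    exists_poly_of_sub_mem_sup hMN hN one_ne_zero (one_mem N) (hMN hx) hxb ht hz hn h
  have hco := coeff_mem_of_twist_sub hM hx hsum _ A hA le_rfl (by
    intro j hj
    have e1 := congrArg (fun R : E[X] => R.coeff j) e
    simp only [coeff_sub] at e1 ⊢
    rw [coeff_C_of_ne_zero (by omega), sub_zero] at e1
    rw [e1]
    exact mem_polys.1 hB j)
  set A' := A - C (A.coeff 0) with hA'
  have hA'M : A' ∈ polys M := by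
    rw [mem_polys]
    intro j
    rcases Nat.eq_zero_or_pos j with rfl | hj
    · simp [hA']
    · rw [hA', coeff_sub, coeff_C_of_ne_zero hj.ne', sub_zero]
      exact hco j hj
  refine ⟨A.coeff 0, mem_polys.1 hA 0, ?_⟩
  have e1 : twist σ 1 β (C (A.coeff 0)) = C (σ (A.coeff 0)) := by simp [twist]
  have e2 : C (σ (A.coeff 0)) - C (A.coeff 0) - C n = B - (twist σ 1 β A' - A') := by
    rw [← e, hA', twist_sub, e1]
    ring
  have e3 := congrArg (fun R : E[X] => R.coeff 0) e2
  simp only [coeff_sub, coeff_C_zero] at e3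
  rw [e3]
  have := mem_polys.1 (sub_mem (twist_mem_polys hM (one_mem M) hx hA'M) hA'M) 0
  rw [coeff_sub] at this
  exact sub_mem (mem_polys.1 hB 0) this

end Twist

/-! ### Chains of intermediate fields and Zorn's lemma -/

section Chain

variable {G : Type u} [Field G] {E : Type v} [Field E] [Algebra G E]

theorem mem_sSup_of_isChain {c : Set (IntermediateField G E)} (hne : c.Nonempty)
    (hc : IsChain (· ≤ ·) c) {x : E} : x ∈ sSup c ↔ ∃ M ∈ c, x ∈ M := by
  have : Nonempty c := hne.to_subtype
  rw [sSup_eq_iSup', ← SetLike.mem_coe, coe_iSup_of_directed hc.directedOn.directed_val]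
  simp

theorem exists_mem_sup_of_isChain {c : Set (IntermediateField G E)} (hne : c.Nonempty)
    (hc : IsChain (· ≤ ·) c) {N : IntermediateField G E} {x : E} (hx : x ∈ N ⊔ sSup c) :
    ∃ M ∈ c, x ∈ N ⊔ M := by
  have h1 : N ⊔ sSup c ≤ sSup ((fun M => N ⊔ M) '' c) := by
    obtain ⟨M, hM⟩ := hne
    refine sup_le (le_sup_left.trans (le_sSup ⟨M, hM, rfl⟩)) (sSup_le fun M hM => ?_)
    exact le_sup_right.trans (le_sSup ⟨M, hM, rfl⟩)
  have h2 : IsChain (· ≤ ·) ((fun M => N ⊔ M) '' c) :=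
    hc.image_of_map_rel _ _ _ fun _ _ h => sup_le_sup_left h N
  obtain ⟨_, ⟨M, hM, rfl⟩, hxM⟩ := (mem_sSup_of_isChain (hne.image _) h2).1 (h1 hx)
  exact ⟨M, hM, hxM⟩

theorem exists_polys_of_forall_mem {c : Set (IntermediateField G E)} (hne : c.Nonempty)
    (hc : IsChain (· ≤ ·) c) {P : E[X]} (h : ∀ n, ∃ M ∈ c, P.coeff n ∈ M) :
    ∃ M ∈ c, P ∈ polys M := by
  have key : ∀ s : Finset ℕ, ∃ M ∈ c, ∀ n ∈ s, P.coeff n ∈ M := by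
    intro s
    induction s using Finset.induction_on with
    | empty =>
      obtain ⟨M, hM⟩ := hne
      exact ⟨M, hM, by simp⟩
    | insert n s _ ih =>
      obtain ⟨M, hM, h1⟩ := ih
      obtain ⟨M', hM', h2⟩ := h n
      rcases hc.total hM hM' with hle | hle
      · refine ⟨M', hM', fun k hk => ?_⟩
        rcases Finset.mem_insert.1 hk with rfl | hk
        exacts [h2, hle (h1 k hk)]
      · refine ⟨M, hM, fun k hk => ?_⟩
        rcases Finset.mem_insert.1 hk with rfl | hk
        exacts [hle h2, h1 k hk]
  obtain ⟨M, hM, h1⟩ := key P.support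
  refine ⟨M, hM, mem_polys.2 fun n => ?_⟩
  by_cases hn : n ∈ P.support
  · exact h1 n hn
  · rw [notMem_support_iff.1 hn]
    exact zero_mem M

/-- An algebraic relation has finitely many coefficients and so already lives over one member of the
chain. -/
theorem transcendental_sup_sSup_of_isChain {c : Set (IntermediateField G E)} (hne : c.Nonempty)
    (hc : IsChain (· ≤ ·) c) {N : IntermediateField G E} {x : E}
    (h : ∀ M ∈ c, Transcendental (M ⊔ N : IntermediateField G E) x) :
    Transcendental (sSup c ⊔ N : IntermediateField G E) x := by
  rw [transcendental_iff_polys]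
  intro P hP h0
  have h2 : IsChain (· ≤ ·) ((fun M => M ⊔ N) '' c) :=
    hc.image_of_map_rel _ _ _ fun _ _ h => sup_le_sup_right h N
  obtain ⟨_, ⟨M, hM, rfl⟩, hPM⟩ := exists_polys_of_forall_mem (hne.image _) h2 (P := P) (by
    intro n
    have := mem_polys.1 hP n
    rw [sup_comm] at this
    obtain ⟨M, hM, hn⟩ := exists_mem_sup_of_isChain hne hc this
    rw [sup_comm] at hn
    exact ⟨_, ⟨M, hM, rfl⟩, hn⟩)
  exact transcendental_iff_polys.1 (h M hM) P hPM h0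

/-- Zorn's lemma for a property of intermediate fields that is preserved by adjoining single
elements of prescribed kinds. -/
theorem exists_closed_under_adjoin (P : IntermediateField G E → Prop)
    (S : IntermediateField G E → Set E) {M₀ : IntermediateField G E} (h0 : P M₀)
    (hstep : ∀ M, M₀ ≤ M → P M → ∀ g ∈ S M, P (M ⊔ G⟮g⟯))
    (hchain : ∀ c : Set (IntermediateField G E), c.Nonempty → IsChain (· ≤ ·) c →
      (∀ M ∈ c, P M) → P (sSup c)) :
    ∃ M, M₀ ≤ M ∧ P M ∧ ∀ g ∈ S M, g ∈ M := by
  obtain ⟨M, hM, hmax⟩ := zorn_le_nonempty₀ {M | P M}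
    (fun c hcP hc y hy => ⟨sSup c, hchain c ⟨y, hy⟩ hc hcP, fun z hz => le_sSup hz⟩) M₀ h0
  refine ⟨M, hM, hmax.1, fun g hg => ?_⟩
  exact hmax.2 (hstep M hM hmax.1 g hg) le_sup_left (self_mem_sup_simple M g)

end Chain

/-! ### Stable subfields and the closure under sums -/

section Stable

variable {G : Type u} [Field G] {E : Type v} [Field E] [Algebra G E] {σ : E ≃+* E}

theorem stable_adjoin (hG : Stable σ (⊥ : IntermediateField G E)) {S : Set E}
    (h : ∀ x ∈ S, σ x ∈ adjoin G S) : Stable σ (adjoin G S) := by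
  intro x hx
  induction hx using adjoin_induction with
  | mem x hx => exact h x hx
  | algebraMap x => exact (bot_le : _ ≤ adjoin G S) (hG _ (IntermediateField.algebraMap_mem _ x))
  | add x y _ _ hx hy => rw [map_add]; exact add_mem hx hy
  | inv x _ hx => rw [map_inv₀]; exact inv_mem hx
  | mul x y _ _ hx hy => rw [map_mul]; exact mul_mem hx hy

theorem Stable.sup {M N : IntermediateField G E} (hM : Stable σ M)
    (hG : Stable σ (⊥ : IntermediateField G E)) (hN : Stable σ N) : Stable σ (M ⊔ N) := by
  refine stable_adjoin hG (S := (M ∪ N : Set E)) ?_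
  rintro x (hx | hx)
  · exact subset_adjoin G _ (Or.inl (hM x hx))
  · exact subset_adjoin G _ (Or.inr (hN x hx))

theorem Stable.sup_adjoin {M : IntermediateField G E} (hM : Stable σ M)
    (hG : Stable σ (⊥ : IntermediateField G E)) {S : Set E} (hS : ∀ x ∈ S, σ x ∈ M ⊔ adjoin G S) :
    Stable σ (M ⊔ adjoin G S) := by
  have e : M ⊔ adjoin G S = adjoin G (M ∪ S : Set E) := by rw [adjoin_union, adjoin_self]
  rw [e] at hS ⊢
  refine stable_adjoin hG ?_
  rintro x (hx | hx)
  · exact subset_adjoin G _ (Or.inl (hM x hx))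
  · exact hS x hx

theorem Stable.sup_simple {M : IntermediateField G E} (hM : Stable σ M)
    (hG : Stable σ (⊥ : IntermediateField G E)) {x : E} (hx : σ x ∈ M ⊔ G⟮x⟯) : Stable σ (M ⊔ G⟮x⟯) :=
  hM.sup_adjoin hG (by simpa using hx)

theorem apply_mem_of_sum {M : IntermediateField G E} {x : E} (hx : σ x - x ∈ M) :
    σ x ∈ M ⊔ G⟮x⟯ := by
  have := add_mem ((le_sup_left : M ≤ M ⊔ G⟮x⟯) hx) (self_mem_sup_simple M x)
  rwa [sub_add_cancel] at this

theorem apply_mem_of_prod {M : IntermediateField G E} {α x : E} (hα : α ∈ M) (hx : σ x = α * x) :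
    σ x ∈ M ⊔ G⟮x⟯ := by
  rw [hx]
  exact mul_mem ((le_sup_left : M ≤ M ⊔ G⟮x⟯) hα) (self_mem_sup_simple M x)

theorem stable_sSup {c : Set (IntermediateField G E)} (hne : c.Nonempty)
    (hc : IsChain (· ≤ ·) c) (h : ∀ M ∈ c, Stable σ M) : Stable σ (sSup c) := by
  intro x hx
  obtain ⟨M, hM, hxM⟩ := (mem_sSup_of_isChain hne hc).1 hx
  exact (mem_sSup_of_isChain hne hc).2 ⟨M, hM, h M hM x hxM⟩

/-- The smallest intermediate field above `M` which contains every `g` whose difference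
`σ g - g` it contains. -/
def sumClosure (σ : E ≃+* E) (M : IntermediateField G E) : IntermediateField G E :=
  sInf {N | M ≤ N ∧ ∀ g, σ g - g ∈ N → g ∈ N}

theorem le_sumClosure (M : IntermediateField G E) : M ≤ sumClosure σ M :=
  le_sInf fun _ h => h.1

theorem sumClosure_le {M N : IntermediateField G E} (h : M ≤ N)
    (hN : ∀ g, σ g - g ∈ N → g ∈ N) : sumClosure σ M ≤ N :=
  sInf_le ⟨h, hN⟩

theorem mem_sumClosure_of_sum {M : IntermediateField G E} {g : E}
    (h : σ g - g ∈ sumClosure σ M) : g ∈ sumClosure σ M := by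
  rw [sumClosure, IntermediateField.mem_sInf] at h ⊢
  exact fun N hN => hN.2 g (h N hN)

/-- A maximal field with the property inside the closure contains all sums over itself, so it is the
whole closure. -/
theorem sumClosure_induction {M₀ : IntermediateField G E} (P : IntermediateField G E → Prop)
    (h0 : P M₀)
    (hstep : ∀ M, M₀ ≤ M → M ≤ sumClosure σ M₀ → P M → ∀ g, σ g - g ∈ M → P (M ⊔ G⟮g⟯))
    (hchain : ∀ c : Set (IntermediateField G E), c.Nonempty → IsChain (· ≤ ·) c →
      (∀ M ∈ c, P M) → P (sSup c)) : P (sumClosure σ M₀) := by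
  obtain ⟨M, hM, ⟨hP, hle⟩, hcl⟩ := exists_closed_under_adjoin
    (fun M => P M ∧ M ≤ sumClosure σ M₀) (fun M => {g | σ g - g ∈ M}) (M₀ := M₀)
    ⟨h0, le_sumClosure M₀⟩
    (fun M hM hP g hg => ⟨hstep M hM hP.2 hP.1 g hg, sup_le hP.2
      (adjoin_simple_le_iff.2 (mem_sumClosure_of_sum (hP.2 hg)))⟩)
    (fun c hne hc h => ⟨hchain c hne hc fun M hM => (h M hM).1, sSup_le fun M hM => (h M hM).2⟩)
  rwa [← le_antisymm hle (sumClosure_le hM hcl)]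

theorem stable_sumClosure (hG : Stable σ (⊥ : IntermediateField G E))
    {M : IntermediateField G E} (hM : Stable σ M) : Stable σ (sumClosure σ M) :=
  sumClosure_induction (Stable σ) hM
    (fun _ _ _ hN _ hg => hN.sup_simple hG (apply_mem_of_sum hg))
    (fun _ hne hc h => stable_sSup hne hc h)

/-- Adjoining one sum at a time preserves transcendence of a product, by
`transcendental_prod_of_sum`, and so does the union of a chain. -/
theorem transcendental_sumClosure_of_prod [CharZero E]
    (hG : Stable σ (⊥ : IntermediateField G E))
    (hk : ∀ c, σ c = c → c ∈ (⊥ : IntermediateField G E)) {M : IntermediateField G E}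
    (hM : Stable σ M) {α y : E} (hα0 : α ≠ 0) (hα : α ∈ M) (hy : σ y = α * y)
    (ht : Transcendental M y) : Transcendental (sumClosure σ M) y := by
  refine (sumClosure_induction (σ := σ) (M₀ := M)
    (fun N => Stable σ N ∧ Transcendental N y) ⟨hM, ht⟩ ?_ ?_).2
  · intro N hMN _ hN g hg
    refine ⟨hN.1.sup_simple hG (apply_mem_of_sum hg), ?_⟩
    exact transcendental_prod_of_sum hN.1 (fun c hc => (bot_le : _ ≤ N) (hk c hc)) hα0 (hMN hα) hy
      hN.2 (hN.1.sup_simple hG (apply_mem_of_prod (hMN hα) hy)) hg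
  · intro c hne hc h
    refine ⟨stable_sSup hne hc fun N hN => (h N hN).1, ?_⟩
    have := transcendental_sup_sSup_of_isChain hne hc (N := ⊥) (x := y)
      (fun N hN => by rw [sup_bot_eq]; exact (h N hN).2)
    rwa [sup_bot_eq] at this

end Stable

/-! ### Independence of intermediate fields and descent of difference equations -/

section Indep

variable {G : Type u} [Field G] {E : Type v} [Field E] [Algebra G E] {σ : E ≃+* E}

/-- Adjoining `B` to a field between `N` and `Ω` neither adds elements of `Ω` to it nor makes
transcendental elements of `Ω` algebraic. -/
def Indep (N Ω B : IntermediateField G E) : Prop :=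
  ∀ M, N ≤ M → M ≤ Ω → ∀ x ∈ Ω, (x ∈ B ⊔ M → x ∈ M) ∧
    (Transcendental M x → Transcendental (B ⊔ M : IntermediateField G E) x)

theorem indep_self (N Ω : IntermediateField G E) : Indep N Ω N := by
  intro M hNM _ x _
  rw [sup_eq_right.2 hNM]
  exact ⟨id, id⟩

theorem Indep.mono {N Ω B B' : IntermediateField G E} (h : Indep N Ω B') (hB : B ≤ B') :
    Indep N Ω B := fun M hM hM' x hx =>
  ⟨fun hxB => (h M hM hM' x hx).1 (sup_le_sup_right hB M hxB),
    fun ht => transcendental_mono (sup_le_sup_right hB M) ((h M hM hM' x hx).2 ht)⟩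

theorem Indep.base {N N₁ Ω B : IntermediateField G E} (h : Indep N Ω B) (hN : N ≤ N₁) :
    Indep N₁ Ω (B ⊔ N₁) := by
  intro M hM hM' x hx
  rw [sup_assoc, sup_eq_right.2 hM]
  exact h M (hN.trans hM) hM' x hx

/-- An element transcendental over everything in sight does no harm: membership is handled by
`mem_of_transcendental`, transcendence by exchange. -/
theorem Indep.sup_simple {N Ω B : IntermediateField G E} (h : Indep N Ω B) {y : E}
    (hy : Transcendental (Ω ⊔ B : IntermediateField G E) y) : Indep N Ω (B ⊔ G⟮y⟯) := by
  intro M hM hM' x hx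
  have hle : B ⊔ M ≤ Ω ⊔ B := sup_le le_sup_right (hM'.trans le_sup_left)
  have hxΩ : x ∈ Ω ⊔ B := (le_sup_left : Ω ≤ _) hx
  rw [sup_right_comm]
  refine ⟨fun hxy => (h M hM hM' x hx).1 (mem_of_transcendental hle hy hxΩ hxy), fun ht => ?_⟩
  exact transcendental_exchange ((h M hM hM' x hx).2 ht)
    (transcendental_mono (sup_le hle (adjoin_simple_le_iff.2 hxΩ)) hy)

theorem indep_sSup {N Ω : IntermediateField G E} {c : Set (IntermediateField G E)}
    (hne : c.Nonempty) (hc : IsChain (· ≤ ·) c) (h : ∀ B ∈ c, Indep N Ω B) :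
    Indep N Ω (sSup c) := by
  intro M hM hM' x hx
  constructor
  · intro hxc
    rw [sup_comm] at hxc
    obtain ⟨B, hB, hxB⟩ := exists_mem_sup_of_isChain hne hc hxc
    rw [sup_comm] at hxB
    exact (h B hB M hM hM' x hx).1 hxB
  · exact fun ht => transcendental_sup_sSup_of_isChain hne hc
      fun B hB => (h B hB M hM hM' x hx).2 ht

variable [CharZero E]

/-- Whenever `n ∈ N'` becomes, up to an element of `M`, a difference `σ z - z` in `N' ⊔ M`, it is
one in `N'` up to an element of `Ω`. -/
def Descends (σ : E ≃+* E) (Ω N' M : IntermediateField G E) : Prop :=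
  ∀ n ∈ N', ∀ z ∈ N' ⊔ M, σ z - z - n ∈ M → ∃ a ∈ N', σ a - a - n ∈ Ω

-- Independence keeps `x` transcendental over `N' ⊔ M`, so the equation can be compared
-- coefficientwise in `x`. If `x` is a sum, this requires that every `u ∈ N' ⊔ M` with `σ u - u ∈ M`
-- lies in `M`: such `u` lies in `Ω`, which is closed under sums, and independence applies.
omit [CharZero E] in
theorem Descends.sup_simple {N Ω N' M : IntermediateField G E}
    (hG : Stable σ (⊥ : IntermediateField G E)) (hΩ : ∀ g, σ g - g ∈ Ω → g ∈ Ω)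
    (hN' : Stable σ N') (hI : Indep N Ω N')
    (hM : Stable σ M) (hNM : N ≤ M) (hMΩ : M ≤ Ω) (h : Descends σ Ω N' M) {x : E} (hxΩ : x ∈ Ω)
    (ht : Transcendental M x) (hx : σ x - x ∈ M ∨ ∃ α ∈ M, α ≠ 0 ∧ σ x = α * x) :
    Descends σ Ω N' (M ⊔ G⟮x⟯) := by
  intro n hn z hz hzn
  rw [← sup_assoc] at hz
  have ht' := (hI M hNM hMΩ x hxΩ).2 ht
  have hst : Stable σ (N' ⊔ M) := hN'.sup hG hM
  have hle : M ≤ N' ⊔ M := le_sup_right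
  have hn' : n ∈ N' ⊔ M := (le_sup_left : N' ≤ _) hn
  obtain ⟨a, ha, han⟩ : ∃ a ∈ N' ⊔ M, σ a - a - n ∈ M := by
    rcases hx with hx | ⟨α, hα, hα0, hx⟩
    · refine exists_sub_mem_of_sum hle hM hst hx ht' ?_ hz hn' hzn
      intro u hu hu'
      exact (hI M hNM hMΩ u (hΩ u (hMΩ hu'))).1 hu
    · exact exists_sub_mem_of_prod hle hst hα0 (hle hα) hx ht' hz hn' hzn
  exact h n hn a ha han

omit [CharZero E] in
theorem descends_sSup {Ω N' : IntermediateField G E} {c : Set (IntermediateField G E)}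
    (hne : c.Nonempty) (hc : IsChain (· ≤ ·) c) (h : ∀ M ∈ c, Descends σ Ω N' M) :
    Descends σ Ω N' (sSup c) := by
  intro n hn z hz hzn
  obtain ⟨M, hM, hzM⟩ := exists_mem_sup_of_isChain hne hc hz
  obtain ⟨M', hM', hnM⟩ := (mem_sSup_of_isChain hne hc).1 hzn
  rcases hc.total hM hM' with hle | hle
  · exact h M' hM' n hn z (sup_le_sup_left hle N' hzM) hnM
  · exact h M hM n hn z hzM (hle hnM)

omit [CharZero E] in
theorem descends_self {Ω N N' : IntermediateField G E} (hN : N ≤ Ω) (hNN' : N ≤ N') :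
    Descends σ Ω N' N := by
  intro n _ z hz hzn
  rw [sup_eq_left.2 hNN'] at hz
  exact ⟨z, hz, hN hzn⟩

theorem descends_sumClosure {N Ω N' M : IntermediateField G E}
    (hG : Stable σ (⊥ : IntermediateField G E))
    (hk : ∀ c, σ c = c → c ∈ (⊥ : IntermediateField G E)) (hΩ : ∀ g, σ g - g ∈ Ω → g ∈ Ω)
    (hN' : Stable σ N') (hI : Indep N Ω N') (hM : Stable σ M) (hNM : N ≤ M) (hMΩ : M ≤ Ω)
    (h : Descends σ Ω N' M) : Descends σ Ω N' (sumClosure σ M) := by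
  refine (sumClosure_induction (σ := σ) (M₀ := M)
    (fun L => Stable σ L ∧ Descends σ Ω N' L) ⟨hM, h⟩ ?_ ?_).2
  · intro L hML hL hP g hg
    refine ⟨hP.1.sup_simple hG (apply_mem_of_sum hg), ?_⟩
    by_cases hgL : g ∈ L
    · rw [sup_simple_eq_of_mem hgL]
      exact hP.2
    have hLΩ : L ≤ Ω := hL.trans (sumClosure_le hMΩ hΩ)
    exact hP.2.sup_simple hG hΩ hN' hI hP.1 (hNM.trans hML) hLΩ (hΩ g (hLΩ hg))
      (transcendental_of_sum hP.1 (fun c hc => (bot_le : _ ≤ L) (hk c hc)) hg hgL) (Or.inl hg)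
  · intro c hne hc hP
    exact ⟨stable_sSup hne hc fun L hL => (hP L hL).1, descends_sSup hne hc fun L hL => (hP L hL).2⟩

/-- One layer of sums: if `N'` is independent from `Ω` over `N`, then so is the field obtained from
`N'` by adjoining `N₁` and all sums over `N'`, over a field `N₁` that contains all sums over `N`. -/
theorem Indep.layer {N N₁ Ω N' : IntermediateField G E}
    (hG : Stable σ (⊥ : IntermediateField G E))
    (hk : ∀ c, σ c = c → c ∈ (⊥ : IntermediateField G E)) (hΩ : ∀ g, σ g - g ∈ Ω → g ∈ Ω)
    (hΩs : Stable σ Ω) (hN' : Stable σ N') (hN₁ : Stable σ N₁) (hI : Indep N Ω N')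
    (hNN₁ : N ≤ N₁) (hNN' : N ≤ N') (hN₁Ω : N₁ ≤ Ω) (hsum : ∀ g, σ g - g ∈ N → g ∈ N₁)
    (hD : Descends σ Ω N' Ω) :
    Indep N₁ Ω (N' ⊔ N₁ ⊔ adjoin G {g | σ g - g ∈ N'}) := by
  -- The third condition on `B`, that sums over `N'` in `Ω ⊔ B` are already in `B`, is what makes
  -- every further sum over `N'` transcendental over `Ω ⊔ B`.
  have key : ∃ B, N' ⊔ N₁ ≤ B ∧ (Stable σ B ∧ Indep N₁ Ω B ∧
      ∀ w ∈ Ω ⊔ B, σ w - w ∈ N' → w ∈ B) ∧ ∀ g ∈ {g | σ g - g ∈ N'}, g ∈ B := by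
    refine exists_closed_under_adjoin
      (fun B => Stable σ B ∧ Indep N₁ Ω B ∧ ∀ w ∈ Ω ⊔ B, σ w - w ∈ N' → w ∈ B)
      (fun _ => {g | σ g - g ∈ N'}) ?_ ?_ ?_
    · refine ⟨hN'.sup hG hN₁, hI.base hNN₁, fun w hw hwN => ?_⟩
      have e : Ω ⊔ (N' ⊔ N₁) = N' ⊔ Ω := by
        rw [sup_left_comm, sup_eq_left.2 hN₁Ω]
      rw [e] at hw
      -- Descent gives `a ∈ N'` such that the difference of `w - a` is in `Ω`. This difference is
      -- also in `N'`, and independence gives `N' ∩ Ω = N`; thus `w - a` is a sum over `N` and lies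
      -- in `N₁`.
      obtain ⟨a, ha, haΩ⟩ := hD _ hwN w hw (by rw [sub_self]; exact zero_mem _)
      have h1 : σ (w - a) - (w - a) ∈ Ω := by
        have := neg_mem haΩ
        rw [map_sub]
        convert this using 1
        ring
      have h2 : w - a ∈ Ω := hΩ _ h1
      have h3 : σ (w - a) - (w - a) ∈ N := by
        refine (hI N le_rfl (hNN₁.trans hN₁Ω) _ h1).1 ?_
        rw [sup_eq_left.2 hNN', map_sub]
        have := sub_mem hwN (sub_mem (hN' a ha) ha)
        convert this using 1
        ring
      have h4 : w - a ∈ N' ⊔ N₁ := (le_sup_right : N₁ ≤ _) (hsum _ h3)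
      have := add_mem h4 ((le_sup_left : N' ≤ N' ⊔ N₁) ha)
      rwa [sub_add_cancel] at this
    · rintro B hB ⟨hBs, hBI, hBc⟩ g hg
      have hN'B : N' ≤ B := le_sup_left.trans hB
      by_cases hgB : g ∈ B
      · rw [sup_simple_eq_of_mem hgB]
        exact ⟨hBs, hBI, hBc⟩
      have hst : Stable σ (Ω ⊔ B) := hΩs.sup hG hBs
      have hkΩ : ∀ c, σ c = c → c ∈ Ω ⊔ B := fun c hc => (bot_le : _ ≤ Ω ⊔ B) (hk c hc)
      have hgΩ : σ g - g ∈ Ω ⊔ B := (hN'B.trans le_sup_right) hg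
      have ht : Transcendental (Ω ⊔ B : IntermediateField G E) g :=
        transcendental_of_sum hst hkΩ hgΩ fun h => hgB (hBc g h hg)
      refine ⟨hBs.sup_simple hG (apply_mem_of_sum (hN'B hg)), hBI.sup_simple ht, ?_⟩
      intro w hw hwN
      rw [← sup_assoc] at hw
      -- A sum in `(Ω ⊔ B)(g)` is `c * g + w'` with a constant `c`; then `w'` is itself a sum over
      -- `N'`, so the old condition applies to it.
      obtain ⟨c, w', hc, hw', rfl⟩ := exists_linear_of_sum hst hkΩ hgΩ ht hw
        ((hN'B.trans le_sup_right) hwN)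
      have hcN : c ∈ N' := (bot_le : _ ≤ N') (hk c hc)
      have hw'B : w' ∈ B := by
        refine hBc w' hw' ?_
        have := sub_mem hwN (mul_mem hcN hg)
        rw [map_add, map_mul, hc] at this
        convert this using 1
        ring
      exact add_mem (mul_mem ((hN'B.trans le_sup_left) hcN) (self_mem_sup_simple B g))
        ((le_sup_left : B ≤ _) hw'B)
    · intro c hne hc h
      refine ⟨stable_sSup hne hc fun B hB => (h B hB).1, indep_sSup hne hc fun B hB => (h B hB).2.1,
        fun w hw hwN => ?_⟩
      obtain ⟨B, hB, hwB⟩ := exists_mem_sup_of_isChain hne hc hw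
      exact le_sSup hB ((h B hB).2.2 w hwB hwN)
  obtain ⟨B, hB, ⟨-, hIB, -⟩, hcl⟩ := key
  exact hIB.mono (sup_le hB (adjoin_le_iff.2 hcl))

end Indep

/-! ### The filtration by depth and freeness of labelled towers -/

section Filtration

variable {G : Type u} [Field G] {E : Type v} [Field E] [Algebra G E] {σ : E ≃+* E}

/-- The fields obtained from `G` by alternately adjoining all sums over the preceding field and
the elements of `X 1`, `X 2`, …. -/
def filt (G : Type u) [Field G] [Algebra G E] (σ : E ≃+* E) (X : ℕ → Set E) :
    ℕ → IntermediateField G E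
  | 0 => ⊥
  | d + 1 => adjoin G (filt G σ X d ∪ X (d + 1) ∪ {g | σ g - g ∈ filt G σ X d})

theorem filt_le_succ (X : ℕ → Set E) (d : ℕ) : filt G σ X d ≤ filt G σ X (d + 1) := by
  intro x hx
  rw [filt]
  exact subset_adjoin G _ (Or.inl (Or.inl hx))

theorem filt_mono (X : ℕ → Set E) {d d' : ℕ} (h : d ≤ d') : filt G σ X d ≤ filt G σ X d' :=
  monotone_nat_of_le_succ (filt_le_succ X) h

theorem mem_filt_succ_of_sum {X : ℕ → Set E} {d : ℕ} {g : E} (h : σ g - g ∈ filt G σ X d) :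
    g ∈ filt G σ X (d + 1) := by
  rw [filt]
  exact subset_adjoin G _ (Or.inr h)

theorem subset_filt_succ (X : ℕ → Set E) (d : ℕ) : X (d + 1) ⊆ filt G σ X (d + 1) := by
  intro x hx
  rw [filt]
  exact subset_adjoin G _ (Or.inl (Or.inr hx))

theorem filt_succ_le {X : ℕ → Set E} {d : ℕ} {M : IntermediateField G E}
    (h1 : filt G σ X d ≤ M) (h2 : X (d + 1) ⊆ M) (h3 : ∀ g, σ g - g ∈ filt G σ X d → g ∈ M) :
    filt G σ X (d + 1) ≤ M := by
  rw [filt, adjoin_le_iff]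
  exact Set.union_subset (Set.union_subset h1 h2) h3

theorem filt_mono_left {X Y : ℕ → Set E} (h : ∀ d, X d ⊆ Y d) (d : ℕ) :
    filt G σ X d ≤ filt G σ Y d := by
  induction d with
  | zero => exact le_rfl
  | succ d ih =>
    exact filt_succ_le (ih.trans (filt_le_succ Y d)) ((h _).trans (subset_filt_succ Y d))
      fun g hg => mem_filt_succ_of_sum (ih hg)

theorem filt_congr {X Y : ℕ → Set E} {d : ℕ} (h : ∀ k ≤ d, X k = Y k) :
    filt G σ X d = filt G σ Y d := by
  induction d with
  | zero => rfl
  | succ d ih =>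
    rw [filt, filt, ih fun k hk => h k (hk.trans d.le_succ), h _ le_rfl]

theorem level_mono {e : ℕ} (t : Fin e → E) {m n : ℕ} (h : m ≤ n) : level G t m ≤ level G t n :=
  adjoin.mono G _ _ (Set.image_mono fun _ hj => lt_of_lt_of_le hj h)

theorem level_zero {e : ℕ} (t : Fin e → E) : level G t 0 = ⊥ := by
  simp [level]

theorem level_succ {e : ℕ} (t : Fin e → E) (j : Fin e) :
    level G t (j + 1) = level G t j ⊔ G⟮t j⟯ := by
  rw [level, level, ← adjoin_union]
  congr 1
  have : {i : Fin e | i.val < j.val + 1} = {i | i.val < j.val} ∪ {j} := by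
    ext i
    simp only [Set.mem_ofPred_eq, Set.union_singleton, Set.mem_insert_iff, Fin.ext_iff]
    omega
  rw [this, Set.image_union, Set.image_singleton]

theorem mem_level {e : ℕ} (t : Fin e → E) {j : Fin e} {m : ℕ} (h : j.val < m) :
    t j ∈ level G t m :=
  subset_adjoin G _ ⟨j, h, rfl⟩

theorem stable_level {e : ℕ} {t a : Fin e → E} (hG : Stable σ (⊥ : IntermediateField G E))
    (ha : ∀ j : Fin e, a j ∈ level G t j) (hs : ∀ j, σ (t j) = a j * t j ∨ σ (t j) = t j + a j) (m : ℕ) :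
    Stable σ (level G t m) := by
  refine stable_adjoin hG ?_
  rintro _ ⟨j, hj, rfl⟩
  have h1 : a j ∈ level G t m := level_mono t (le_of_lt hj) (ha j)
  have h2 : t j ∈ level G t m := mem_level t hj
  rcases hs j with h | h <;> rw [h]
  exacts [mul_mem h1 h2, add_mem h2 h1]

/-- A tuple of products and sums with coefficients `a`, where `δ` bounds the depths: the
coefficient `a j` only involves preceding generators of smaller label. -/
structure IsLabelled (G : Type u) [Field G] [Algebra G E] (σ : E ≃+* E) {e : ℕ} (t a : Fin e → E)
    (δ : Fin e → ℕ) : Prop where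
  pos : ∀ j, 0 < δ j
  mem : ∀ j, a j ∈ adjoin G (t '' {i | i < j ∧ δ i < δ j})
  shift : ∀ j, (a j ≠ 0 ∧ σ (t j) = a j * t j) ∨ σ (t j) = t j + a j

/-- The generators of label at most `d` among the first `q` ones. -/
def gens {α : Type*} {e : ℕ} (t : Fin e → α) (δ : Fin e → ℕ) (q d : ℕ) : Set α :=
  t '' {j | j.val < q ∧ δ j ≤ d}

theorem gens_mono {α : Type*} {e : ℕ} (t : Fin e → α) (δ : Fin e → ℕ) {q q' : ℕ} (h : q ≤ q') (d : ℕ) :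
    gens t δ q d ⊆ gens t δ q' d :=
  Set.image_mono fun _ hj => ⟨lt_of_lt_of_le hj.1 h, hj.2⟩

/-- All generators among the first `q` ones of label larger than `d` are transcendental over the
`d`-th field of the filtration and the preceding generators. -/
def IsFree (G : Type u) [Field G] [Algebra G E] (σ : E ≃+* E) {e : ℕ} (t : Fin e → E)
    (δ : Fin e → ℕ) (q : ℕ) : Prop :=
  ∀ (d : ℕ) (j : Fin e), j.val < q → d < δ j →
    Transcendental (filt G σ (gens t δ q) d ⊔ level G t j : IntermediateField G E) (t j)

section Labelled

variable {e : ℕ} {t a : Fin e → E} {δ : Fin e → ℕ}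

theorem IsLabelled.mem_level (h : IsLabelled G σ t a δ) (j : Fin e) : a j ∈ level G t j :=
  adjoin.mono G _ _ (Set.image_mono fun _ hi => hi.1) (h.mem j)

theorem IsLabelled.stable_level (h : IsLabelled G σ t a δ)
    (hG : Stable σ (⊥ : IntermediateField G E)) (m : ℕ) : Stable σ (level G t m) :=
  DiffField.stable_level hG h.mem_level (fun j => (h.shift j).imp And.right id) m

theorem IsLabelled.gen_mem_filt (h : IsLabelled G σ t a δ) {q d : ℕ} {j : Fin e} (hj : j.val < q)
    (hd : δ j ≤ d) : t j ∈ filt G σ (gens t δ q) d := by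
  obtain ⟨d, rfl⟩ : ∃ d', d = d' + 1 := ⟨d - 1, by have := h.pos j; omega⟩
  exact subset_filt_succ _ d ⟨j, ⟨hj, hd⟩, rfl⟩

theorem IsLabelled.coeff_mem_filt (h : IsLabelled G σ t a δ) {q d : ℕ} {j : Fin e}
    (hj : j.val ≤ q) (hd : δ j ≤ d + 1) : a j ∈ filt G σ (gens t δ q) d := by
  refine (adjoin_le_iff.2 ?_ : _ ≤ filt G σ (gens t δ q) d) (h.mem j)
  rintro _ ⟨i, ⟨hij, hi⟩, rfl⟩
  exact h.gen_mem_filt (lt_of_lt_of_le hij hj) (by omega)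

theorem IsLabelled.stable_filt (h : IsLabelled G σ t a δ)
    (hG : Stable σ (⊥ : IntermediateField G E)) (q d : ℕ) :
    Stable σ (filt G σ (gens t δ q) d) := by
  induction d with
  | zero => exact hG
  | succ d ih =>
    have hle := filt_le_succ (G := G) (σ := σ) (gens t δ q) d
    have key : ∀ x ∈ (filt G σ (gens t δ q) d ∪ gens t δ q (d + 1) ∪
        {g | σ g - g ∈ filt G σ (gens t δ q) d} : Set E), σ x ∈ filt G σ (gens t δ q) (d + 1) := by
      rintro x ((hx | ⟨j, ⟨hj, hd⟩, rfl⟩) | hx)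
      · exact hle (ih x hx)
      · have h1 := hle (h.coeff_mem_filt hj.le hd)
        have h2 := h.gen_mem_filt hj hd
        rcases h.shift j with ⟨-, e⟩ | e <;> rw [e]
        exacts [mul_mem h1 h2, add_mem h2 h1]
      · have := add_mem (hle hx) (mem_filt_succ_of_sum hx)
        rwa [sub_add_cancel] at this
    rw [filt] at key ⊢
    exact stable_adjoin hG key

theorem IsLabelled.filt_le_sumClosure (q d : ℕ) :
    filt G σ (gens t δ q) d ≤ sumClosure σ (level G t q) := by
  induction d with
  | zero => exact bot_le
  | succ d ih =>
    refine filt_succ_le ih ?_ fun g hg => mem_sumClosure_of_sum (ih hg)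
    rintro _ ⟨j, ⟨hj, -⟩, rfl⟩
    exact le_sumClosure _ (DiffField.mem_level t hj)

/-- A sum among the generators does not contribute to the filtration. -/
theorem IsLabelled.filt_succ_eq_of_sum (h : IsLabelled G σ t a δ) {j : Fin e}
    (hj : σ (t j) = t j + a j) (d : ℕ) :
    filt G σ (gens t δ (j + 1)) d = filt G σ (gens t δ j) d := by
  refine le_antisymm ?_ (filt_mono_left (gens_mono t δ (Nat.le_succ _)) d)
  induction d with
  | zero => exact le_rfl
  | succ d ih =>
    refine filt_succ_le (ih.trans (filt_le_succ _ d)) ?_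
      fun g hg => mem_filt_succ_of_sum (ih hg)
    rintro _ ⟨i, ⟨hi, hd⟩, rfl⟩
    rcases Nat.lt_succ_iff_lt_or_eq.1 hi with hi | hi
    · exact h.gen_mem_filt hi hd
    · obtain rfl : i = j := Fin.ext hi
      refine mem_filt_succ_of_sum ?_
      rw [hj, add_sub_cancel_left]
      exact h.coeff_mem_filt le_rfl hd

/-- The descent climbs from `N` to `Ω`: generators of label at most `d` are already in `N`, the
others are transcendental over `N` and their predecessors by freeness, and the closure under sums of
the field so reached is `Ω`. -/
theorem IsFree.descends [CharZero E] (h : IsLabelled G σ t a δ)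
    (hG : Stable σ (⊥ : IntermediateField G E))
    (hk : ∀ c, σ c = c → c ∈ (⊥ : IntermediateField G E)) {q : ℕ} (hq : q ≤ e)
    (hF : IsFree G σ t δ q) {d : ℕ} {N' : IntermediateField G E} (hN' : Stable σ N')
    (hNN' : filt G σ (gens t δ q) d ≤ N')
    (hI : Indep (filt G σ (gens t δ q) d) (sumClosure σ (level G t q)) N') :
    Descends σ (sumClosure σ (level G t q)) N' (sumClosure σ (level G t q)) := by
  set Ω := sumClosure σ (level G t q) with hΩ
  set N := filt G σ (gens t δ q) d with hN
  have hNΩ : N ≤ Ω := IsLabelled.filt_le_sumClosure q d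
  have hΩc : ∀ g, σ g - g ∈ Ω → g ∈ Ω := fun g hg => mem_sumClosure_of_sum hg
  have hNs : Stable σ N := h.stable_filt hG q d
  have hle : ∀ m ≤ q, N ⊔ level G t m ≤ Ω :=
    fun m hm => sup_le hNΩ ((level_mono t hm).trans (le_sumClosure _))
  have key : ∀ m ≤ q, Descends σ Ω N' (N ⊔ level G t m) := by
    intro m
    induction m with
    | zero =>
      intro _
      rw [level_zero, sup_bot_eq]
      exact descends_self hNΩ hNN'
    | succ m ih =>
      intro hm
      obtain ⟨j, rfl⟩ : ∃ j : Fin e, j.val = m := ⟨⟨m, by omega⟩, rfl⟩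
      have ih := ih (by omega)
      rw [level_succ, ← sup_assoc]
      by_cases hd : δ j ≤ d
      · rwa [sup_simple_eq_of_mem ((le_sup_left : N ≤ _) (h.gen_mem_filt (by omega) hd))]
      · have haj : a j ∈ N ⊔ level G t j := (le_sup_right : level G t j ≤ _) (h.mem_level j)
        refine ih.sup_simple hG hΩc hN' hI (hNs.sup hG (h.stable_level hG _)) le_sup_left
          (hle _ (by omega)) (le_sumClosure _ (DiffField.mem_level t (by omega)))
          (hF d j (by omega) (by omega)) ?_
        rcases h.shift j with ⟨h0, e⟩ | e
        · exact Or.inr ⟨a j, haj, h0, e⟩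
        · left
          rwa [e, add_sub_cancel_left]
  have h1 := descends_sumClosure hG hk hΩc hN' hI (hNs.sup hG (h.stable_level hG q)) le_sup_left
    (hle q le_rfl) (key q le_rfl)
  have h2 : sumClosure σ (N ⊔ level G t q) = Ω :=
    le_antisymm (sumClosure_le (hle q le_rfl) hΩc)
      (sumClosure_le (le_sup_right.trans (le_sumClosure _)) fun g hg => mem_sumClosure_of_sum hg)
  rwa [h2] at h1

/-- Freeness is preserved when a product is added to the tuple. -/
theorem IsFree.succ_of_prod [CharZero E] (h : IsLabelled G σ t a δ)
    (hG : Stable σ (⊥ : IntermediateField G E))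
    (hk : ∀ c, σ c = c → c ∈ (⊥ : IntermediateField G E)) {j : Fin e}
    (hF : IsFree G σ t δ j) (hj0 : a j ≠ 0) (hj : σ (t j) = a j * t j)
    (ht : Transcendental (level G t j) (t j)) : IsFree G σ t δ (j + 1) := by
  set Ω := sumClosure σ (level G t j) with hΩ
  set X := gens t δ j with hX
  set Y := gens t δ (j + 1) with hY
  have hXY : ∀ d, X d ⊆ Y d := gens_mono t δ (Nat.le_succ _)
  have hΩc : ∀ g, σ g - g ∈ Ω → g ∈ Ω := fun g hg => mem_sumClosure_of_sum hg
  have hΩs : Stable σ Ω := stable_sumClosure hG (h.stable_level hG _)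
  have hXΩ : ∀ d, filt G σ X d ≤ Ω := IsLabelled.filt_le_sumClosure _
  have hy : Transcendental Ω (t j) :=
    transcendental_sumClosure_of_prod hG hk (h.stable_level hG _) hj0 (h.mem_level j) hj ht
  have hlt : ∀ d < δ j, filt G σ Y d = filt G σ X d := by
    intro d hd
    refine filt_congr fun k hk => Set.Subset.antisymm ?_ (hXY k)
    rintro _ ⟨i, ⟨hi, hik⟩, rfl⟩
    refine ⟨i, ⟨lt_of_le_of_ne (Nat.lt_succ_iff.1 hi) fun hij => ?_, hik⟩, rfl⟩
    rw [Fin.ext hij] at hik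
    omega
  have hYle : ∀ d (M : IntermediateField G E), filt G σ X (d + 1) ≤ M → filt G σ Y d ≤ M →
      (δ j ≤ d + 1 → t j ∈ M) → (∀ g, σ g - g ∈ filt G σ Y d → g ∈ M) →
      filt G σ Y (d + 1) ≤ M := by
    intro d M h1 h2 h3 h4
    refine filt_succ_le h2 ?_ h4
    rintro _ ⟨i, ⟨hi, hd⟩, rfl⟩
    rcases Nat.lt_succ_iff_lt_or_eq.1 hi with hi | hi
    · exact h1 (h.gen_mem_filt hi hd)
    · obtain rfl : i = j := Fin.ext hi
      exact h3 hd
  -- Below the label of `t j` the filtration is unchanged. At that label only `t j` is new, and it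
  -- is transcendental over `Ω`. Above it `Indep.layer` carries independence from one level to the
  -- next.
  have hInd : ∀ d, Indep (filt G σ X d) Ω (filt G σ Y d) := by
    intro d
    induction d with
    | zero => exact indep_self _ _
    | succ d ih =>
      rcases lt_trichotomy (δ j) (d + 1) with hd | hd | hd
      · have hlay := Indep.layer hG hk hΩc hΩs (h.stable_filt hG _ d) (h.stable_filt hG _ (d + 1))
          ih (filt_le_succ X d) (filt_mono_left hXY d) (hXΩ _) (fun g hg => mem_filt_succ_of_sum hg)
          (IsFree.descends h hG hk j.isLt.le hF (h.stable_filt hG _ d) (filt_mono_left hXY d) ih)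
        refine hlay.mono (hYle d _ (le_sup_right.trans le_sup_left) (le_sup_left.trans le_sup_left)
          (fun _ => ?_) fun g hg => ?_)
        · exact (le_sup_left.trans le_sup_left : filt G σ Y d ≤ _)
            (h.gen_mem_filt (Nat.lt_succ_self _) (by omega))
        · exact (le_sup_right : adjoin G _ ≤ _) (subset_adjoin G _ hg)
      · have hXs := indep_self (filt G σ X (d + 1)) Ω
        rw [← sup_eq_left.2 (hXΩ (d + 1))] at hy
        refine (hXs.sup_simple hy).mono (hYle d _ le_sup_left ?_ (fun _ => self_mem_sup_simple _ _)
          fun g hg => ?_)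
        · rw [hlt d (by omega)]
          exact (filt_le_succ X d).trans le_sup_left
        · rw [hlt d (by omega)] at hg
          exact (le_sup_left : filt G σ X (d + 1) ≤ _) (mem_filt_succ_of_sum hg)
      · rw [hlt _ hd]
        exact indep_self _ _
  intro d i hi hd
  have hle : ∀ m ≤ j.val, filt G σ X d ⊔ level G t m ≤ Ω :=
    fun m hm => sup_le (hXΩ d) ((level_mono t hm).trans (le_sumClosure _))
  rcases Nat.lt_succ_iff_lt_or_eq.1 hi with hi | hi
  -- An old generator lies in `Ω`, so independence transfers its freeness to the enlarged
  -- filtration.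
  · refine transcendental_mono ?_ ((hInd d _ le_sup_left (hle i hi.le) (t i)
      (le_sumClosure _ (DiffField.mem_level t hi))).2 (hF d i hi hd))
    exact sup_le_sup_left le_sup_right _
  · obtain rfl : i = j := Fin.ext hi
    rw [← hY, hlt d hd]
    exact transcendental_mono (hle _ le_rfl) hy

end Labelled

end Filtration

/-! ### Occurrence of generators and depth, read off from generated subfields -/

section Occurs

variable {G : Type u} [Field G] {E : Type v} [Field E] [Algebra G E]

theorem transcendental_of_algebraicIndependent {ι : Type*} {T : ι → E}
    (hT : AlgebraicIndependent G T) {S : Set ι} {i : ι} (hi : i ∉ S) :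
    Transcendental (adjoin G (T '' S)) (T i) :=
  transcendental_adjoin_iff.2 (hT.transcendental_adjoin hi)

theorem algebraicIndependent_of_transcendental_level {n : ℕ} {T : Fin n → E}
    (h : ∀ i : Fin n, Transcendental (level G T i) (T i)) : AlgebraicIndependent G T := by
  have key : ∀ m ≤ n, AlgebraicIndepOn G T {j : Fin n | j.val < m} := by
    intro m
    induction m with
    | zero =>
      intro _
      have : IsEmpty {j : Fin n | j.val < 0} := ⟨fun j => absurd j.2 (Nat.not_lt_zero _)⟩
      exact algebraicIndependent_empty_type
    | succ m ih =>
      intro hm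
      have e : {j : Fin n | j.val < m + 1} = insert ⟨m, hm⟩ {j : Fin n | j.val < m} := by
        ext j
        simp only [Set.mem_ofPred_eq, Set.mem_insert_iff, Fin.ext_iff]
        omega
      rw [e]
      exact (ih (by omega)).insert (transcendental_adjoin_iff.1 (h ⟨m, hm⟩))
  have := key n le_rfl
  rw [show {j : Fin n | j.val < n} = Set.univ from Set.eq_univ_of_forall fun j => j.isLt] at this
  exact AlgebraicIndepOn.univ.1 this

theorem mem_adjoin_image_iff {ι : Type*} {T : ι → E} {S : Set ι} {g : E} :
    g ∈ adjoin G (T '' S) ↔ ∃ P ∈ MvPolynomial.supported G S, ∃ Q ∈ MvPolynomial.supported G S,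
      g = MvPolynomial.aeval T P / MvPolynomial.aeval T Q := by
  have e : Algebra.adjoin G (T '' S) = (MvPolynomial.supported G S).map (MvPolynomial.aeval T) := by
    rw [MvPolynomial.supported_eq_adjoin_X, AlgHom.map_adjoin, ← Set.image_comp]
    congr 2
    ext i
    simp
  rw [mem_adjoin_iff_div, e]
  constructor
  · rintro ⟨_, ⟨P, hP, rfl⟩, _, ⟨Q, hQ, rfl⟩, rfl⟩
    exact ⟨P, hP, Q, hQ, rfl⟩
  · rintro ⟨P, hP, Q, hQ, rfl⟩
    exact ⟨_, ⟨P, hP, rfl⟩, _, ⟨Q, hQ, rfl⟩, rfl⟩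

theorem vars_subset_of_dvd {n : ℕ} {p P : MvPolynomial (Fin n) G} (h : p ∣ P) (hP : P ≠ 0) :
    p.vars ⊆ P.vars := by
  obtain ⟨r, rfl⟩ := h
  intro i hi
  rw [MvPolynomial.mem_vars_iff_degreeOf_ne_zero] at hi ⊢
  rw [MvPolynomial.degreeOf_mul_eq (left_ne_zero_of_mul hP) (right_ne_zero_of_mul hP)]
  omega

variable {n : ℕ} {T A : Fin n → E}

/-- Comparing a reduced fraction `p / q` with any other fraction `P / Q` of the same value gives `p
∣ P` and `q ∣ Q`, and a divisor of a nonzero polynomial has no further variables. -/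
theorem Occurs.mem_of_mem_adjoin (hT : AlgebraicIndependent G T) {S : Set (Fin n)} {g : E}
    (hg : g ∈ adjoin G (T '' S)) {j : Fin n} (h : Occurs G T j g) : j ∈ S := by
  obtain ⟨p, q, hpq, hq, rfl, hj⟩ := h
  obtain ⟨P, hP, Q, hQ, e⟩ := mem_adjoin_image_iff.1 hg
  have hinj : Function.Injective (MvPolynomial.aeval (R := G) T) := hT
  have hq0 : q ≠ 0 := by
    rintro rfl
    simp at hq
  obtain ⟨P, Q, hP, hQ, hQ0, e⟩ : ∃ P Q : MvPolynomial (Fin n) G, P ∈ MvPolynomial.supported G S ∧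
      Q ∈ MvPolynomial.supported G S ∧ Q ≠ 0 ∧ p * Q = P * q := by
    -- A zero denominator gives the value `0` by convention; the fraction `0 / 1` replaces it.
    by_cases hQ0 : Q = 0
    · refine ⟨0, 1, zero_mem _, one_mem _, one_ne_zero, ?_⟩
      rw [hQ0, map_zero, div_zero, div_eq_zero_iff, or_iff_left hq,
        map_eq_zero_iff _ hinj] at e
      rw [e]
      simp
    · refine ⟨P, Q, hP, hQ, hQ0, hinj ?_⟩
      rw [div_eq_div_iff hq ((map_ne_zero_iff _ hinj).2 hQ0)] at e
      simpa using e
  rcases hj with hj | hj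
  · have hp0 : p ≠ 0 := by
      rintro rfl
      simp at hj
    have hP0 : P ≠ 0 := by
      rintro rfl
      rw [zero_mul] at e
      exact mul_ne_zero hp0 hQ0 e
    have hdvd : p ∣ P := hpq.dvd_of_dvd_mul_right ⟨Q, e.symm⟩
    exact MvPolynomial.mem_supported.1 hP (vars_subset_of_dvd hdvd hP0 hj)
  · have hdvd : q ∣ Q := hpq.symm.dvd_of_dvd_mul_left ⟨P, by rw [e, mul_comm]⟩
    exact MvPolynomial.mem_supported.1 hQ (vars_subset_of_dvd hdvd hQ0 hj)

/-- A reduced fraction exists because the polynomial ring is factorial, and all its variables occur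
by definition. -/
theorem mem_adjoin_occurs (hT : AlgebraicIndependent G T) {g : E}
    (hg : g ∈ adjoin G (Set.range T)) : g ∈ adjoin G (T '' {j | Occurs G T j g}) := by
  have hinj : Function.Injective (MvPolynomial.aeval (R := G) T) := hT
  rw [← Set.image_univ, mem_adjoin_image_iff] at hg
  obtain ⟨P, -, Q, -, hg⟩ := hg
  by_cases hQ : Q = 0
  · rw [hg, hQ, map_zero, div_zero]
    exact zero_mem _
  obtain ⟨q, p, c, hqp, hq, hp⟩ := UniqueFactorizationMonoid.exists_reduced_factors Q hQ P
  have hq0 : q ≠ 0 := by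
    rintro rfl
    exact hQ (by rw [← hq, mul_zero])
  have hc0 : c ≠ 0 := by
    rintro rfl
    exact hQ (by rw [← hq, zero_mul])
  have hq1 := (map_ne_zero_iff _ hinj).2 hq0
  have e : g = MvPolynomial.aeval T p / MvPolynomial.aeval T q := by
    rw [hg, ← hq, ← hp, map_mul, map_mul, mul_div_mul_left _ _ ((map_ne_zero_iff _ hinj).2 hc0)]
  refine mem_adjoin_image_iff.2 ⟨p, ?_, q, ?_, e⟩
  · rw [MvPolynomial.mem_supported]
    exact fun j hj => ⟨p, q, hqp.symm, hq1, e, Or.inl hj⟩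
  · rw [MvPolynomial.mem_supported]
    exact fun j hj => ⟨p, q, hqp.symm, hq1, e, Or.inr hj⟩

theorem depth_le_iff {g : E} {d : ℕ} :
    depth G T A g ≤ d ↔ ∀ j, Occurs G T j g → genDepth G T A j ≤ d := by
  rw [depth, Finset.sup_le_iff]
  refine ⟨fun h j hj => ?_, fun h j _ => ?_⟩
  · have := h j (Finset.mem_univ j)
    rwa [if_pos hj] at this
  · split_ifs with hj
    exacts [h j hj, Nat.zero_le d]

theorem genDepth_pos (i : Fin n) : 0 < genDepth G T A i := by
  rw [genDepth]
  exact Nat.succ_pos _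

theorem genDepth_le_succ_iff {i : Fin n} {d : ℕ} :
    genDepth G T A i ≤ d + 1 ↔ ∀ j < i, Occurs G T j (A i) → genDepth G T A j ≤ d := by
  rw [genDepth, Nat.add_le_add_iff_right, Finset.sup_le_iff]
  refine ⟨fun h j hji hj => ?_, fun h j _ => ?_⟩
  · have := h ⟨j, hji⟩ (Finset.mem_univ _)
    rwa [if_pos (by exact hj)] at this
  · split_ifs with hj
    exacts [h _ j.isLt hj, Nat.zero_le d]

theorem level_le_adjoin_range {T : Fin n → E} (m : ℕ) : level G T m ≤ adjoin G (Set.range T) :=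
  adjoin.mono G _ _ (Set.image_subset_range _ _)

theorem depth_le_iff_mem_adjoin (hT : AlgebraicIndependent G T) {g : E}
    (hg : g ∈ adjoin G (Set.range T)) {d : ℕ} :
    depth G T A g ≤ d ↔ g ∈ adjoin G (T '' {j | genDepth G T A j ≤ d}) := by
  rw [depth_le_iff]
  exact ⟨fun h => adjoin.mono G _ _ (Set.image_mono fun j hj => h j hj) (mem_adjoin_occurs hT hg),
    fun h j hj => Occurs.mem_of_mem_adjoin hT h hj⟩

theorem genDepth_eq_depth_add_one (hT : AlgebraicIndependent G T) {i : Fin n}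
    (hA : A i ∈ level G T i) : genDepth G T A i = depth G T A (A i) + 1 := by
  have key : ∀ d, genDepth G T A i ≤ d + 1 ↔ depth G T A (A i) ≤ d := by
    intro d
    rw [genDepth_le_succ_iff, depth_le_iff]
    exact ⟨fun h j hj => h j (Occurs.mem_of_mem_adjoin hT hA hj) hj, fun h j _ hj => h j hj⟩
  have h1 := genDepth_pos (G := G) (T := T) (A := A) i
  have h2 := key (genDepth G T A i - 1)
  have h3 := key (depth G T A (A i))
  omega

theorem genDepth_le_succ_iff_mem_adjoin (hT : AlgebraicIndependent G T) {i : Fin n}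
    (hA : A i ∈ level G T i) {d : ℕ} :
    genDepth G T A i ≤ d + 1 ↔ A i ∈ adjoin G (T '' {j | genDepth G T A j ≤ d}) := by
  rw [genDepth_eq_depth_add_one hT hA, Nat.add_le_add_iff_right,
    depth_le_iff_mem_adjoin hT (level_le_adjoin_range _ hA)]

/-- Bounds on depths become membership in subfields. Unlike coprime representations, this is easy to
transport along embeddings and permutations. -/
theorem genDepth_le_succ_iff_mem_adjoin_lt (hT : AlgebraicIndependent G T) {i : Fin n}
    (hA : A i ∈ level G T i) {d : ℕ} :
    genDepth G T A i ≤ d + 1 ↔ A i ∈ adjoin G (T '' {j | j < i ∧ genDepth G T A j ≤ d}) := by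
  rw [genDepth_le_succ_iff]
  constructor
  · intro h
    refine adjoin.mono G _ _ (Set.image_mono fun j hj => ?_)
      (mem_adjoin_occurs hT (level_le_adjoin_range _ hA))
    have hji : j < i := Occurs.mem_of_mem_adjoin hT hA hj
    exact ⟨hji, h j hji hj⟩
  · exact fun h j _ hj => (Occurs.mem_of_mem_adjoin hT h hj).2

theorem coeff_mem_adjoin_genDepth_lt (hT : AlgebraicIndependent G T) {i : Fin n}
    (hA : A i ∈ level G T i) :
    A i ∈ adjoin G (T '' {j | j < i ∧ genDepth G T A j < genDepth G T A i}) := by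
  have h0 := genDepth_pos (G := G) (T := T) (A := A) i
  have := (genDepth_le_succ_iff_mem_adjoin_lt hT hA (d := genDepth G T A i - 1)).1 (by omega)
  refine adjoin.mono G _ _ (Set.image_mono fun j (hj : _ ∧ _) => ?_) this
  exact ⟨hj.1, by omega⟩

theorem map_mem_adjoin_image_iff {L : Type*} [Field L] [Algebra G L] (φ : L →ₐ[G] E) {ι : Type*}
    (x : ι → L) (S : Set ι) (b : L) :
    φ b ∈ adjoin G ((fun i => φ (x i)) '' S) ↔ b ∈ adjoin G (x '' S) := by
  have e : (fun i => φ (x i)) '' S = φ '' (x '' S) := by rw [← Set.image_comp]; rfl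
  rw [e, ← adjoin_map]
  constructor
  · rintro ⟨c, hc, hcb⟩
    rwa [← φ.injective hcb]
  · exact fun h => ⟨b, h, rfl⟩

/-- Depths do not change when the tuple is mapped into another field and extended. -/
theorem genDepth_eq_of_map {L : Type*} [Field L] [Algebra G L] (φ : L →ₐ[G] E) {m : ℕ}
    {x b : Fin m → L} (h : m ≤ n) (hT : AlgebraicIndependent G T)
    (hx : ∀ j, T (Fin.castLE h j) = φ (x j)) (hb : ∀ j, A (Fin.castLE h j) = φ (b j))
    (hbl : ∀ j : Fin m, b j ∈ level G x j) (j : Fin m) :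
    genDepth G T A (Fin.castLE h j) = genDepth G x b j := by
  have hTx : (fun i => φ (x i)) = T ∘ Fin.castLE h := funext fun i => (hx i).symm
  have hxi : AlgebraicIndependent G x := by
    refine AlgebraicIndependent.of_comp φ ?_
    change AlgebraicIndependent G fun i => φ (x i)
    rw [hTx]
    exact hT.comp _ (Fin.castLE_injective h)
  have hmem : ∀ (S : Set (Fin m)) (c : L),
      φ c ∈ adjoin G (T '' (Fin.castLE h '' S)) ↔ c ∈ adjoin G (x '' S) := by
    intro S c
    rw [← map_mem_adjoin_image_iff φ, hTx, Set.image_comp]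
  have himg : ∀ (j : Fin m) (Q : Fin n → Prop), {k | k < Fin.castLE h j ∧ Q k} =
      Fin.castLE h '' {i | i < j ∧ Q (Fin.castLE h i)} := by
    intro j Q
    ext k
    constructor
    · rintro ⟨hk, hQ⟩
      exact ⟨⟨k, lt_trans hk j.isLt⟩, ⟨hk, hQ⟩, rfl⟩
    · rintro ⟨i, ⟨hi, hQ⟩, rfl⟩
      exact ⟨hi, hQ⟩
  have hAl : ∀ j, A (Fin.castLE h j) ∈ level G T (Fin.castLE h j) := by
    intro j
    have e : {k : Fin n | k.val < (Fin.castLE h j).val} = Fin.castLE h '' {i | i.val < j.val} := by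
      have := himg j fun _ => True
      simp only [and_true] at this
      exact this
    rw [hb, level, e, hmem]
    exact hbl j
  induction j using WellFoundedLT.induction with
  | ind j ih =>
    have key : ∀ d, genDepth G T A (Fin.castLE h j) ≤ d + 1 ↔ genDepth G x b j ≤ d + 1 := by
      intro d
      rw [genDepth_le_succ_iff_mem_adjoin_lt hT (hAl j),
        genDepth_le_succ_iff_mem_adjoin_lt hxi (hbl j), himg j fun k => genDepth G T A k ≤ d, hb,
        hmem]
      have e : {i | i < j ∧ genDepth G T A (Fin.castLE h i) ≤ d} =
          {i | i < j ∧ genDepth G x b i ≤ d} := by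
        ext i
        simp only [Set.mem_ofPred_eq]
        exact and_congr_right fun hi => by rw [ih i hi]
      rw [e]
    have h1 := genDepth_pos (G := G) (T := T) (A := A) (Fin.castLE h j)
    have h2 := genDepth_pos (G := G) (T := x) (A := b) j
    have h3 := key (genDepth G T A (Fin.castLE h j) - 1)
    have h4 := key (genDepth G x b j - 1)
    omega

/-- Depths do not depend on the order of the generators. -/
theorem genDepth_comp_perm (hT : AlgebraicIndependent G T) (hA : ∀ i : Fin n, A i ∈ level G T i)
    {τ : Equiv.Perm (Fin n)} (hτ : IsAdmissible G T A τ) (i : Fin n) :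
    genDepth G (T ∘ τ) (A ∘ τ) i = genDepth G T A (τ i) := by
  have hTτ : AlgebraicIndependent G (T ∘ τ) := hT.comp _ τ.injective
  have himg : ∀ Q : Fin n → Prop, (T ∘ τ) '' {k | Q (τ k)} = T '' {k | Q k} := by
    intro Q
    rw [Set.image_comp]
    congr 1
    exact Set.image_preimage_eq {k | Q k} τ.surjective
  induction i using WellFoundedLT.induction with
  | ind i ih =>
    -- For the original tower the criterion without the condition `j < i` is used: the field
    -- generated by all generators of depth at most `d` does not see the order.
    have key : ∀ d, genDepth G (T ∘ τ) (A ∘ τ) i ≤ d + 1 ↔ genDepth G T A (τ i) ≤ d + 1 := by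
      intro d
      rw [genDepth_le_succ_iff_mem_adjoin hT (hA _), ← himg fun k => genDepth G T A k ≤ d]
      constructor
      · intro h
        rw [genDepth_le_succ_iff_mem_adjoin_lt hTτ (hτ i)] at h
        refine adjoin.mono G _ _ (Set.image_mono fun k hk => ?_) h
        have := hk.2
        rwa [ih k hk.1] at this
      · intro h
        rw [genDepth_le_succ_iff]
        intro k hk hko
        rw [ih k hk]
        exact Occurs.mem_of_mem_adjoin hTτ h hko
    have h1 := genDepth_pos (G := G) (T := T ∘ τ) (A := A ∘ τ) i
    have h2 := genDepth_pos (G := G) (T := T) (A := A) (τ i)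
    have h3 := key (genDepth G (T ∘ τ) (A ∘ τ) i - 1)
    have h4 := key (genDepth G T A (τ i) - 1)
    omega

end Occurs

/-! ### Exchange in finite sequences -/

section Sequence

variable {G : Type u} [Field G] {E : Type v} [Field E] [Algebra G E]

/-- In a sequence whose members lie in `M` or are transcendental over `M` and the preceding ones,
the latter ones are transcendental over `M` and all other members. -/
theorem transcendental_sup_compl {M : IntermediateField G E} {n : ℕ} {T : Fin n → E}
    (h : ∀ j : Fin n, T j ∈ M ∨ Transcendental (M ⊔ level G T j : IntermediateField G E) (T j))
    {q : Fin n} (hq : Transcendental (M ⊔ level G T q : IntermediateField G E) (T q)) :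
    Transcendental (M ⊔ adjoin G (T '' {q}ᶜ) : IntermediateField G E) (T q) := by
  have key : ∀ m, q.val + 1 ≤ m → m ≤ n → Transcendental
      (M ⊔ adjoin G (T '' {i : Fin n | i.val < m ∧ i ≠ q}) : IntermediateField G E) (T q) := by
    intro m hm
    induction m, hm using Nat.le_induction with
    | base =>
      intro _
      refine transcendental_mono (sup_le_sup_left (adjoin.mono G _ _ (Set.image_mono ?_)) M) hq
      rintro i ⟨hi, hiq⟩
      have : i.val ≠ q.val := fun e => hiq (Fin.ext e)
      change i.val < q.val
      omega
    | succ m hm ih =>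
      intro hmn
      have ih := ih (by omega)
      set j : Fin n := ⟨m, hmn⟩ with hj
      have hle : (M ⊔ adjoin G (T '' {i : Fin n | i.val < m + 1 ∧ i ≠ q}) : IntermediateField G E) ≤
          M ⊔ adjoin G (T '' {i : Fin n | i.val < m ∧ i ≠ q}) ⊔ G⟮T j⟯ := by
        refine sup_le (le_sup_left.trans le_sup_left) (adjoin_le_iff.2 ?_)
        rintro _ ⟨i, ⟨hi, hiq⟩, rfl⟩
        rcases Nat.lt_succ_iff_lt_or_eq.1 hi with hi | hi
        · exact (le_sup_right.trans le_sup_left : adjoin G (T '' _) ≤ _)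
            (subset_adjoin G _ ⟨i, ⟨hi, hiq⟩, rfl⟩)
        · obtain rfl : i = j := Fin.ext hi
          exact self_mem_sup_simple _ _
      refine transcendental_mono hle ?_
      rcases h j with hjM | hjt
      · rwa [sup_simple_eq_of_mem ((le_sup_left : M ≤ _) hjM)]
      -- `T j` is transcendental over `M` and its predecessors, `T q` among them, so exchange lets
      -- it be adjoined below `T q`.
      · refine transcendental_exchange ih (transcendental_mono ?_ hjt)
        refine sup_le (sup_le le_sup_left ?_) ?_
        · refine le_sup_of_le_right (adjoin.mono G _ _ (Set.image_mono fun i hi => hi.1))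
        · exact le_sup_of_le_right (adjoin_simple_le_iff.2 (mem_level T hm))
  refine transcendental_mono (sup_le_sup_left (adjoin.mono G _ _ (Set.image_mono ?_)) M)
    (key n q.isLt le_rfl)
  exact fun i hi => ⟨i.isLt, hi⟩

end Sequence

/-! ### Realizing elements of the filtration in finite towers of sums -/

section SumTower

variable {G : Type u} [Field G] {E : Type v} [Field E] [Algebra G E] {σ : E ≃+* E}

theorem level_eq_adjoin_range {n : ℕ} (T : Fin n → E) : level G T n = adjoin G (Set.range T) := by
  rw [level, ← Set.image_univ]
  congr 2
  exact Set.eq_univ_of_forall fun j => j.isLt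

/-- A tuple that starts with `t₁, …, t_q` and continues with `r` sums of label at most `d`. -/
structure IsSumTower (G : Type u) [Field G] [Algebra G E] (σ : E ≃+* E) {e : ℕ} (t a : Fin e → E)
    (δ : Fin e → ℕ) {q : ℕ} (hq : q ≤ e) (d : ℕ) {r : ℕ} (T A : Fin (q + r) → E)
    (lab : Fin (q + r) → ℕ) : Prop where
  labelled : IsLabelled G σ T A lab
  base : ∀ j : Fin q, T (Fin.castAdd r j) = t (Fin.castLE hq j) ∧
    A (Fin.castAdd r j) = a (Fin.castLE hq j) ∧ lab (Fin.castAdd r j) = δ (Fin.castLE hq j)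
  new : ∀ k : Fin r, T (Fin.natAdd q k) ∉ level G T (q + k)
  sum : ∀ k : Fin r, σ (T (Fin.natAdd q k)) = T (Fin.natAdd q k) + A (Fin.natAdd q k)
  le : ∀ k : Fin r, lab (Fin.natAdd q k) ≤ d

variable {e : ℕ} {t a : Fin e → E} {δ : Fin e → ℕ} {q : ℕ} {hq : q ≤ e}

theorem IsSumTower.mono {d d' r : ℕ} {T A : Fin (q + r) → E} {lab : Fin (q + r) → ℕ}
    (h : IsSumTower G σ t a δ hq d T A lab) (hd : d ≤ d') :
    IsSumTower G σ t a δ hq d' T A lab :=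
  { h with le := fun k => (h.le k).trans hd }

theorem isSumTower_zero (h : IsLabelled G σ t a δ) (hq : q ≤ e) (d : ℕ) :
    IsSumTower G σ t a δ hq d (r := 0) (fun i => t (Fin.castLE hq i)) (fun i => a (Fin.castLE hq i))
      (fun i => δ (Fin.castLE hq i)) where
  labelled :=
    { pos := fun j => h.pos _
      mem := fun j => by
        refine adjoin.mono G _ _ ?_ (h.mem (Fin.castLE hq j))
        rintro _ ⟨i, ⟨hij, hi⟩, rfl⟩
        exact ⟨⟨i, lt_trans hij j.isLt⟩, ⟨hij, hi⟩, rfl⟩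
      shift := fun j => h.shift _ }
  base := fun j => ⟨rfl, rfl, rfl⟩
  new := fun k => k.elim0
  sum := fun k => k.elim0
  le := fun k => k.elim0

theorem snoc_image {α : Type*} {n : ℕ} (T : Fin n → α) (g : α) (S : Set (Fin n)) :
    (Fin.snoc T g : Fin (n + 1) → α) '' (Fin.castSucc '' S) = T '' S := by
  rw [← Set.image_comp]
  congr 1
  funext i
  simp

theorem level_snoc {n : ℕ} (T : Fin n → E) (g : E) {m : ℕ} (hm : m ≤ n) :
    level G (Fin.snoc T g : Fin (n + 1) → E) m = level G T m := by
  rw [level, level, ← snoc_image T g]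
  congr 2
  ext i
  constructor
  · intro hi
    exact ⟨⟨i, lt_of_lt_of_le hi hm⟩, hi, rfl⟩
  · rintro ⟨j, hj, rfl⟩
    exact hj

/-- The members of a tower of sums of label at most `d` generate this field. -/
def labelField (G : Type u) [Field G] [Algebra G E] {n : ℕ} (T : Fin n → E) (lab : Fin n → ℕ)
    (d : ℕ) : IntermediateField G E :=
  adjoin G (T '' {i | lab i ≤ d})

theorem labelField_mono {n : ℕ} (T : Fin n → E) (lab : Fin n → ℕ) {d d' : ℕ} (h : d ≤ d') :
    labelField G T lab d ≤ labelField G T lab d' :=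
  adjoin.mono G _ _ (Set.image_mono fun _ hi => le_trans hi h)

theorem labelField_le_snoc {n : ℕ} (T : Fin n → E) (lab : Fin n → ℕ) (g : E) (l d : ℕ) :
    labelField G T lab d ≤
      labelField G (Fin.snoc T g : Fin (n + 1) → E) (Fin.snoc lab l : Fin (n + 1) → ℕ) d := by
  refine adjoin.mono G _ _ ?_
  rintro _ ⟨i, hi, rfl⟩
  refine ⟨i.castSucc, ?_, by simp⟩
  change (Fin.snoc lab l : Fin (n + 1) → ℕ) i.castSucc ≤ d
  rwa [Fin.snoc_castSucc]

theorem IsLabelled.snoc {n : ℕ} {T A : Fin n → E} {lab : Fin n → ℕ} (h : IsLabelled G σ T A lab)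
    {g b : E} {l : ℕ} (hg : σ g = g + b) (hb : b ∈ labelField G T lab l) :
    IsLabelled G σ (Fin.snoc T g : Fin (n + 1) → E) (Fin.snoc A b : Fin (n + 1) → E)
      (Fin.snoc lab (l + 1) : Fin (n + 1) → ℕ) where
  pos := fun j => by
    refine Fin.lastCases ?_ (fun j => ?_) j
    · rw [Fin.snoc_last]
      exact l.succ_pos
    · rw [Fin.snoc_castSucc]
      exact h.pos j
  mem := fun j => by
    refine Fin.lastCases ?_ (fun j => ?_) j
    · rw [Fin.snoc_last, Fin.snoc_last]
      refine adjoin.mono G _ _ ?_ hb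
      rintro _ ⟨i, hi, rfl⟩
      refine ⟨i.castSucc, ⟨Fin.castSucc_lt_last i, ?_⟩, by simp⟩
      rw [Fin.snoc_castSucc]
      exact Nat.lt_succ_of_le hi
    · rw [Fin.snoc_castSucc, Fin.snoc_castSucc]
      refine adjoin.mono G _ _ ?_ (h.mem j)
      rintro _ ⟨i, ⟨hij, hi⟩, rfl⟩
      refine ⟨i.castSucc, ⟨hij, ?_⟩, by simp⟩
      rwa [Fin.snoc_castSucc]
  shift := fun j => by
    refine Fin.lastCases ?_ (fun j => ?_) j
    · rw [Fin.snoc_last, Fin.snoc_last]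
      exact Or.inr hg
    · rw [Fin.snoc_castSucc, Fin.snoc_castSucc]
      exact h.shift j

theorem IsSumTower.snoc {d r : ℕ} {T A : Fin (q + r) → E} {lab : Fin (q + r) → ℕ}
    (h : IsSumTower G σ t a δ hq (d + 1) T A lab) {g b : E} (hg : σ g = g + b)
    (hb : b ∈ labelField G T lab d) (hgT : g ∉ adjoin G (Set.range T)) :
    IsSumTower G σ t a δ hq (d + 1) (r := r + 1) (Fin.snoc T g : Fin (q + r + 1) → E)
      (Fin.snoc A b : Fin (q + r + 1) → E) (Fin.snoc lab (d + 1) : Fin (q + r + 1) → ℕ) where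
  labelled := h.labelled.snoc hg hb
  base := fun j => by
    have e : (Fin.castAdd (r + 1) j : Fin (q + r + 1)) = (Fin.castAdd r j).castSucc := rfl
    rw [e, Fin.snoc_castSucc, Fin.snoc_castSucc, Fin.snoc_castSucc]
    exact h.base j
  new := fun k => by
    refine Fin.lastCases ?_ (fun k => ?_) k
    · have e : (Fin.natAdd q (Fin.last r) : Fin (q + r + 1)) = Fin.last (q + r) := rfl
      rw [e, Fin.snoc_last, Fin.val_last, level_snoc T g le_rfl, level_eq_adjoin_range]
      exact hgT
    · have e : (Fin.natAdd q k.castSucc : Fin (q + r + 1)) = (Fin.natAdd q k).castSucc := rfl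
      rw [e, Fin.snoc_castSucc, Fin.val_castSucc, level_snoc T g (by omega)]
      exact h.new k
  sum := fun k => by
    refine Fin.lastCases ?_ (fun k => ?_) k
    · have e : (Fin.natAdd q (Fin.last r) : Fin (q + r + 1)) = Fin.last (q + r) := rfl
      rw [e, Fin.snoc_last, Fin.snoc_last]
      exact hg
    · have e : (Fin.natAdd q k.castSucc : Fin (q + r + 1)) = (Fin.natAdd q k).castSucc := rfl
      rw [e, Fin.snoc_castSucc, Fin.snoc_castSucc]
      exact h.sum k
  le := fun k => by
    refine Fin.lastCases ?_ (fun k => ?_) k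
    · have e : (Fin.natAdd q (Fin.last r) : Fin (q + r + 1)) = Fin.last (q + r) := rfl
      rw [e, Fin.snoc_last]
    · have e : (Fin.natAdd q k.castSucc : Fin (q + r + 1)) = (Fin.natAdd q k).castSucc := rfl
      rw [e, Fin.snoc_castSucc]
      exact h.le k

theorem IsSumTower.level_le {d r : ℕ} {T A : Fin (q + r) → E} {lab : Fin (q + r) → ℕ}
    (h : IsSumTower G σ t a δ hq d T A lab) : level G t q ≤ adjoin G (Set.range T) := by
  refine adjoin_le_iff.2 ?_
  rintro _ ⟨j, hj, rfl⟩
  exact subset_adjoin G _ ⟨Fin.castAdd r ⟨j, hj⟩, (h.base ⟨j, hj⟩).1⟩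

theorem IsSumTower.gen_mem_labelField {d r : ℕ} {T A : Fin (q + r) → E} {lab : Fin (q + r) → ℕ}
    (h : IsSumTower G σ t a δ hq d T A lab) {j : Fin e} (hj : j.val < q) {d' : ℕ}
    (hd : δ j ≤ d') : t j ∈ labelField G T lab d' := by
  obtain ⟨h1, -, h3⟩ := h.base ⟨j, hj⟩
  refine subset_adjoin G _ ⟨Fin.castAdd r ⟨j, hj⟩, ?_, h1⟩
  change lab _ ≤ d'
  rw [h3]
  exact hd

theorem IsSumTower.mem_filt (hL : IsLabelled G σ t a δ) {d r : ℕ} {T A : Fin (q + r) → E}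
    {lab : Fin (q + r) → ℕ} (h : IsSumTower G σ t a δ hq d T A lab) (i : Fin (q + r)) {d' : ℕ}
    (hd : lab i ≤ d') : T i ∈ filt G σ (gens t δ q) d' := by
  induction i using WellFoundedLT.induction generalizing d' with
  | ind i ih =>
    induction i using Fin.addCases with
    | left j =>
      obtain ⟨h1, -, h3⟩ := h.base j
      rw [h1]
      exact hL.gen_mem_filt j.isLt (h3 ▸ hd)
    | right k =>
      have h0 := h.labelled.pos (Fin.natAdd q k)
      obtain ⟨d', rfl⟩ : ∃ m, d' = m + 1 := ⟨d' - 1, by omega⟩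
      refine mem_filt_succ_of_sum ?_
      rw [h.sum k, add_sub_cancel_left]
      refine (adjoin_le_iff.2 ?_ : _ ≤ filt G σ (gens t δ q) d') (h.labelled.mem _)
      rintro _ ⟨i, ⟨hi, hil⟩, rfl⟩
      exact ih i hi (by omega)

/-- Over the field `W` of label at most `d`, the tower is generated by the `t j` of larger label. By
freeness each of these is transcendental over the `d`-th field of the filtration, which contains `W`
and `g`, and its predecessors; so adjoining it cannot capture `g`. -/
theorem IsSumTower.notMem_range (hL : IsLabelled G σ t a δ) (hF : IsFree G σ t δ q) {d r : ℕ}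
    {T A : Fin (q + r) → E} {lab : Fin (q + r) → ℕ} (h : IsSumTower G σ t a δ hq d T A lab) {g : E}
    (hg : g ∈ filt G σ (gens t δ q) d) (hgW : g ∉ labelField G T lab d) :
    g ∉ adjoin G (Set.range T) := by
  set W := labelField G T lab d with hW
  have hWΩ : W ≤ filt G σ (gens t δ q) d := by
    refine adjoin_le_iff.2 ?_
    rintro _ ⟨i, hi, rfl⟩
    exact h.mem_filt hL i hi
  have key : ∀ m ≤ q, g ∉ W ⊔ level G t m := by
    intro m
    induction m with
    | zero =>
      intro _
      rwa [level_zero, sup_bot_eq]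
    | succ m ih =>
      intro hm
      obtain ⟨j, rfl⟩ : ∃ j : Fin e, j.val = m := ⟨⟨m, by omega⟩, rfl⟩
      rw [level_succ, ← sup_assoc]
      by_cases hd : δ j ≤ d
      · rw [sup_simple_eq_of_mem
          ((le_sup_left : W ≤ _) (h.gen_mem_labelField (by omega) hd))]
        exact ih (by omega)
      · intro hgj
        exact ih (by omega) (mem_of_transcendental (sup_le_sup_right hWΩ _)
          (hF d j (by omega) (by omega)) ((le_sup_left : filt G σ (gens t δ q) d ≤ _) hg) hgj)
  refine fun hgT => key q le_rfl ((adjoin_le_iff.2 ?_ : adjoin G (Set.range T) ≤ _) hgT)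
  rintro _ ⟨i, rfl⟩
  induction i using Fin.addCases with
  | left j =>
    rw [(h.base j).1]
    exact (le_sup_right : level G t q ≤ _) (mem_level t j.isLt)
  | right k =>
    exact (le_sup_left : W ≤ _) (subset_adjoin G _ ⟨_, h.le k, rfl⟩)

-- By induction on `d`: finitely many sums over the `d`-th field suffice to generate `Z`, and a
-- tower of label at most `d` contains their differences. The sums are then appended one by one with
-- label `d + 1`, skipping those already generated in that label; the others lie outside the whole
-- tower by `IsSumTower.notMem_range`.
open Classical in
theorem exists_isSumTower (hL : IsLabelled G σ t a δ) (hq : q ≤ e) (hF : IsFree G σ t δ q) (d : ℕ) :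
    ∀ Z : Finset E, (∀ z ∈ Z, z ∈ filt G σ (gens t δ q) d) →
      ∃ (r : ℕ) (T A : Fin (q + r) → E) (lab : Fin (q + r) → ℕ),
        IsSumTower G σ t a δ hq d T A lab ∧ ∀ z ∈ Z, z ∈ labelField G T lab d := by
  induction d with
  | zero =>
    intro Z hZ
    exact ⟨0, _, _, _, isSumTower_zero hL hq 0, fun z hz => (bot_le : ⊥ ≤ labelField G _ _ 0) (hZ z hz)⟩
  | succ d ih =>
    intro Z hZ
    have h1 : ∀ z ∈ Z, ∃ S : Finset E, (S : Set E) ⊆ filt G σ (gens t δ q) d ∪ gens t δ q (d + 1) ∪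
        {g | σ g - g ∈ filt G σ (gens t δ q) d} ∧ z ∈ adjoin G (S : Set E) := by
      intro z hz
      have := hZ z hz
      rw [filt] at this
      exact exists_finset_of_mem_adjoin this
    choose! S hS hzS using h1
    set U := Z.biUnion S with hU
    set V := U.filter fun g => σ g - g ∈ filt G σ (gens t δ q) d with hV
    obtain ⟨r, T, A, lab, hT, hTZ⟩ := ih
      (U.filter (fun g => g ∈ filt G σ (gens t δ q) d) ∪ V.image fun g => σ g - g) (by
        intro z hz
        rcases Finset.mem_union.1 hz with hz | hz
        · exact (Finset.mem_filter.1 hz).2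
        · obtain ⟨g, hg, rfl⟩ := Finset.mem_image.1 hz
          exact (Finset.mem_filter.1 hg).2)
    have key : ∀ V' ⊆ V, ∃ (r : ℕ) (T A : Fin (q + r) → E) (lab : Fin (q + r) → ℕ),
        IsSumTower G σ t a δ hq (d + 1) T A lab ∧
        (∀ z ∈ U.filter (fun g => g ∈ filt G σ (gens t δ q) d) ∪ V.image (fun g => σ g - g),
          z ∈ labelField G T lab d) ∧ ∀ z ∈ V', z ∈ labelField G T lab (d + 1) := by
      intro V'
      induction V' using Finset.induction_on with
      | empty => exact fun _ => ⟨r, T, A, lab, hT.mono d.le_succ, hTZ, by simp⟩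
      | insert g V' _ ihV =>
        intro hgV
        obtain ⟨r, T, A, lab, hT, h1, h2⟩ := ihV ((Finset.subset_insert g V').trans hgV)
        have hg : g ∈ V := hgV (Finset.mem_insert_self g V')
        by_cases hgW : g ∈ labelField G T lab (d + 1)
        · refine ⟨r, T, A, lab, hT, h1, fun z hz => ?_⟩
          rcases Finset.mem_insert.1 hz with rfl | hz
          exacts [hgW, h2 z hz]
        · have hgΩ : g ∈ filt G σ (gens t δ q) (d + 1) :=
            mem_filt_succ_of_sum (Finset.mem_filter.1 hg).2
          refine ⟨r + 1, _, _, _, hT.snoc (b := σ g - g) (by ring) (h1 _ ?_)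
            (hT.notMem_range hL hF hgΩ hgW), fun z hz => labelField_le_snoc T lab g _ d (h1 z hz),
            fun z hz => ?_⟩
          · exact Finset.mem_union_right _ (Finset.mem_image_of_mem _ hg)
          · rcases Finset.mem_insert.1 hz with rfl | hz
            · refine subset_adjoin G _ ⟨Fin.last _, ?_, Fin.snoc_last _ _⟩
              exact le_of_eq (Fin.snoc_last (α := fun _ => ℕ) _ _)
            · exact labelField_le_snoc T lab g _ _ (h2 z hz)
    obtain ⟨r, T, A, lab, hT, h1, h2⟩ := key V le_rfl
    refine ⟨r, T, A, lab, hT, fun z hz => (adjoin_le_iff.2 ?_ : adjoin G (S z : Set E) ≤ _)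
      (hzS z hz)⟩
    intro g hg
    have hgU : g ∈ U := Finset.mem_biUnion.2 ⟨z, hz, hg⟩
    rcases hS z hz hg with (hg | ⟨j, ⟨hj, hd⟩, rfl⟩) | hg
    · exact labelField_mono T lab d.le_succ
        (h1 g (Finset.mem_union_left _ (Finset.mem_filter.2 ⟨hgU, hg⟩)))
    · exact hT.gen_mem_labelField hj hd
    · exact h2 g (Finset.mem_filter.2 ⟨hgU, hg⟩)

open Classical in
theorem exists_isSumTower_of_mem_sup (hL : IsLabelled G σ t a δ) (hq : q ≤ e)
    (hF : IsFree G σ t δ q) {d : ℕ} {x : E} (hx : x ∈ filt G σ (gens t δ q) d ⊔ level G t q) :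
    ∃ (r : ℕ) (T A : Fin (q + r) → E) (lab : Fin (q + r) → ℕ),
      IsSumTower G σ t a δ hq d T A lab ∧ x ∈ adjoin G (Set.range T) := by
  rw [IntermediateField.sup_def] at hx
  obtain ⟨S, hS, hxS⟩ := exists_finset_of_mem_adjoin hx
  obtain ⟨r, T, A, lab, hT, h1⟩ := exists_isSumTower hL hq hF d
    (S.filter fun g => g ∈ filt G σ (gens t δ q) d) fun z hz => (Finset.mem_filter.1 hz).2
  refine ⟨r, T, A, lab, hT, (adjoin_le_iff.2 ?_ : adjoin G (S : Set E) ≤ _) hxS⟩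
  intro g hg
  rcases hS hg with h | h
  · exact adjoin.mono G _ _ (Set.image_subset_range _ _) (h1 g (Finset.mem_filter.2 ⟨hg, h⟩))
  · exact hT.level_le h

end SumTower

/-! ### Transport along embeddings -/

section Map

variable {G : Type u} [Field G] {L : Type*} [Field L] [Algebra G L] {E : Type v} [Field E]
  [Algebra G E]

theorem transcendental_map_iff (φ : L →ₐ[G] E) {K : IntermediateField G L} {x : L} :
    Transcendental (K.map φ) (φ x) ↔ Transcendental K x := by
  rw [transcendental_iff_polys, transcendental_iff_polys]
  constructor
  · intro h P hP h0
    refine (Polynomial.map_eq_zero (φ : L →+* E)).1 (h _ (mem_polys.2 fun n => ?_) ?_)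
    · rw [coeff_map]
      exact ⟨_, mem_polys.1 hP n, rfl⟩
    · change (P.map (φ : L →+* E)).eval ((φ : L →+* E) x) = 0
      rw [eval_map_apply, h0, map_zero]
  · intro h P hP h0
    have h1 : P ∈ lifts (φ : L →+* E) := by
      rw [lifts_iff_coeff_lifts]
      intro n
      obtain ⟨y, -, hy⟩ := mem_polys.1 hP n
      exact ⟨y, hy⟩
    obtain ⟨Q, rfl⟩ := (mem_lifts P).1 h1
    rw [Polynomial.map_eq_zero]
    refine h Q (mem_polys.2 fun n => ?_) ?_
    · obtain ⟨y, hyK, hy⟩ := mem_polys.1 hP n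
      rw [coeff_map] at hy
      rwa [← φ.injective hy]
    · refine (φ : L →+* E).injective ?_
      rw [map_zero, ← eval_map_apply]
      exact h0

theorem map_level (φ : L →ₐ[G] E) {n : ℕ} (T : Fin n → L) (m : ℕ) :
    (level G T m).map φ = level G (φ ∘ T) m := by
  rw [level, level, adjoin_map, Set.image_comp]

theorem level_eq_of_castLE {n m : ℕ} (h : m ≤ n) {T : Fin n → E} {x : Fin m → E}
    (hx : ∀ i, T (Fin.castLE h i) = x i) {k : ℕ} (hk : k ≤ m) : level G T k = level G x k := by
  rw [level, level]
  congr 1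
  ext y
  constructor
  · rintro ⟨i, hi, rfl⟩
    exact ⟨⟨i, lt_of_lt_of_le hi hk⟩, hi, (hx _).symm⟩
  · rintro ⟨i, hi, rfl⟩
    exact ⟨Fin.castLE h i, hi, hx i⟩

end Map

/-! ### Restricting the automorphism to a tower -/

section Restrict

variable {G : Type u} [Field G] {E : Type v} [Field E] [Algebra G E] {σ : E ≃+* E}

theorem IsExtension.stable_bot {σG : G ≃+* G} (h : IsExtension σG σ) :
    Stable σ (⊥ : IntermediateField G E) := by
  rintro _ ⟨g, rfl⟩
  exact ⟨σG g, (h g).symm⟩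

theorem IsExtension.symm {σG : G ≃+* G} (h : IsExtension σG σ) :
    IsExtension σG.symm σ.symm := by
  intro g
  rw [RingEquiv.symm_apply_eq, h, RingEquiv.apply_symm_apply]

/-- The automorphism of `K` induced by `σ`. -/
def restrict (σ : E ≃+* E) (K : IntermediateField G E) (h : Stable σ K) (h' : Stable σ.symm K) :
    K ≃+* K where
  toFun x := ⟨σ x, h x x.2⟩
  invFun x := ⟨σ.symm x, h' x x.2⟩
  left_inv _ := Subtype.ext (σ.symm_apply_apply _)
  right_inv _ := Subtype.ext (σ.apply_symm_apply _)
  map_mul' _ _ := Subtype.ext (map_mul σ _ _)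
  map_add' _ _ := Subtype.ext (map_add σ _ _)

/-- Stability under `σ` does not by itself give stability under the inverse. It follows along the
tower by solving the shift equations for `σ.symm (t j)`, which for a product uses `a j ≠ 0`. -/
theorem IsLabelled.stable_symm_level {e : ℕ} {t a : Fin e → E} {δ : Fin e → ℕ}
    (h : IsLabelled G σ t a δ) (hG : Stable σ.symm (⊥ : IntermediateField G E)) {m : ℕ}
    (hm : m ≤ e) : Stable σ.symm (level G t m) := by
  induction m with
  | zero => rwa [level_zero]
  | succ m ih =>
    have ih := ih (by omega)
    obtain ⟨j, rfl⟩ : ∃ j : Fin e, j.val = m := ⟨⟨m, hm⟩, rfl⟩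
    rw [level_succ]
    refine ih.sup_simple hG ?_
    have ha := (le_sup_left : level G t j ≤ level G t j ⊔ G⟮t j⟯) (ih _ (h.mem_level j))
    have ht := self_mem_sup_simple (level G t j) (t j)
    rcases h.shift j with ⟨h0, e1⟩ | e1
    · have e2 : t j = σ.symm (a j) * σ.symm (t j) := by
        rw [← map_mul, ← e1, RingEquiv.symm_apply_apply]
      have e3 : σ.symm (t j) = t j / σ.symm (a j) := by
        rw [eq_div_iff ((_root_.map_ne_zero _).2 h0), mul_comm, ← e2]
      rw [e3]
      exact div_mem ht ha
    · have e2 : t j = σ.symm (t j) + σ.symm (a j) := by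
        rw [← map_add, ← e1, RingEquiv.symm_apply_apply]
      have e3 : σ.symm (t j) = t j - σ.symm (a j) := by rw [eq_sub_iff_add_eq, ← e2]
      rw [e3]
      exact sub_mem ht ha

/-- The depth is the smallest labelling, since whatever occurs in a coefficient has smaller label.
-/
theorem IsLabelled.genDepth_le {e : ℕ} {t a : Fin e → E} {δ : Fin e → ℕ}
    (h : IsLabelled G σ t a δ) (ht : AlgebraicIndependent G t) (i : Fin e) :
    genDepth G t a i ≤ δ i := by
  induction i using WellFoundedLT.induction with
  | ind i ih =>
    have h0 := h.pos i
    obtain ⟨d, hd⟩ : ∃ d, δ i = d + 1 := ⟨δ i - 1, by omega⟩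
    rw [hd, genDepth_le_succ_iff]
    intro j hj ho
    have := (Occurs.mem_of_mem_adjoin ht (h.mem i) ho).2
    have := ih j hj
    omega

end Restrict

/-! ### `ΠΣ^δ`-extensions are free -/

section Tower

variable {G : Type u} [Field G] {F : Type v} [Field F] [Algebra G F] {σG : G ≃+* G} {σ : F ≃+* F}
  {e : ℕ} {t a : Fin e → F}

theorem IsPiSigmaStar.transcendental (h : IsPiSigmaStar σG σ t a) (i : Fin e) :
    Transcendental (level G t i) (t i) :=
  (h.step i).elim (fun h => h.transcendental) fun h => h.transcendental

theorem IsPiSigmaStar.mem (h : IsPiSigmaStar σG σ t a) (i : Fin e) : a i ∈ level G t i :=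
  (h.step i).elim (fun h => h.mem) fun h => h.mem

theorem IsPiSigmaStar.shift (h : IsPiSigmaStar σG σ t a) (i : Fin e) :
    (a i ≠ 0 ∧ σ (t i) = a i * t i) ∨ σ (t i) = t i + a i :=
  (h.step i).imp (fun h => ⟨h.ne_zero, h.shift⟩) fun h => h.shift

theorem IsPiSigmaStar.algebraicIndependent (h : IsPiSigmaStar σG σ t a) :
    AlgebraicIndependent G t :=
  algebraicIndependent_of_transcendental_level h.transcendental

theorem IsPiSigmaStar.const (h : IsPiSigmaStar σG σ t a) {c : F} (hc : σ c = c) :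
    c ∈ (⊥ : IntermediateField G F) := by
  have key : ∀ m ≤ e, c ∈ level G t m → c ∈ (⊥ : IntermediateField G F) := by
    intro m
    induction m with
    | zero =>
      intro _ hm
      rwa [level_zero] at hm
    | succ m ih =>
      intro hm hcm
      obtain ⟨j, rfl⟩ : ∃ j : Fin e, j.val = m := ⟨⟨m, hm⟩, rfl⟩
      refine ih (by omega) ?_
      rw [level_succ, ← restrictScalars_adjoin_eq_sup, mem_restrictScalars] at hcm
      exact (h.step j).elim (fun h => h.const c hcm hc) fun h => h.const c hcm hc
  refine key e le_rfl ?_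
  rw [level_eq_adjoin_range, h.top]
  exact mem_top

variable {E : Type v} [Field E] [Algebra G E] {σ' : E ≃+* E}

theorem IsPiSigmaStar.isLabelled (h : IsPiSigmaStar σG σ t a) (ψ : F →ₐ[G] E)
    (hψ : ∀ x, ψ (σ x) = σ' (ψ x)) :
    IsLabelled G σ' (ψ ∘ t) (ψ ∘ a) (genDepth G t a) where
  pos := genDepth_pos
  mem j := (map_mem_adjoin_image_iff ψ t _ _).2
    (coeff_mem_adjoin_genDepth_lt h.algebraicIndependent (h.mem j))
  shift j := by
    refine (h.shift j).imp (fun h => ⟨(_root_.map_ne_zero ψ).2 h.1, ?_⟩) fun h => ?_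
    · rw [Function.comp_apply, ← hψ, h.2, map_mul]
      rfl
    · rw [Function.comp_apply, ← hψ, h, map_add]
      rfl

/-- A tower of sums of small label above `t₁, …, t_q` which contains `t_q` shows that `t_q` is not
depth-optimal. -/
theorem IsPiSigmaStar.not_isDepthOptimal [CharZero E] (h : IsPiSigmaStar σG σ t a) (ψ : F →ₐ[G] E)
    (hψ : ∀ x, ψ (σ x) = σ' (ψ x)) (hG : IsExtension σG σ')
    (hk : ∀ c, σ' c = c → c ∈ (⊥ : IntermediateField G E)) {q : Fin e}
    (hq : σ (t q) = t q + a q) {d r : ℕ} (hd : d < genDepth G t a q)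
    {T A : Fin (q.val + r) → E} {lab : Fin (q.val + r) → ℕ}
    (hT : IsSumTower G σ' (ψ ∘ t) (ψ ∘ a) (genDepth G t a) q.isLt.le d T A lab)
    (hx : ψ (t q) ∈ adjoin G (Set.range T)) : ¬ IsDepthOptimal G σ t a q := by
  set K : IntermediateField G E := adjoin G (Set.range T) with hK
  have hKl : K = level G T (q.val + r) := (level_eq_adjoin_range T).symm
  have hKs : Stable σ' K := hKl ▸ hT.labelled.stable_level hG.stable_bot _
  have hKs' : Stable σ'.symm K := hKl ▸ hT.labelled.stable_symm_level hG.symm.stable_bot le_rfl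
  have hAK : ∀ i, A i ∈ K := fun i => level_le_adjoin_range _ (hT.labelled.mem_level i)
  have htr : ∀ i : Fin (q.val + r), Transcendental (level G T i) (T i) := by
    intro i
    induction i using Fin.addCases with
    | left j =>
      have e1 : level G T (Fin.castAdd r j) = (level G t j).map ψ := by
        rw [map_level]
        refine (level_eq_of_castLE (x := (ψ ∘ t) ∘ Fin.castLE q.isLt.le)
          (Nat.le_add_right q.val r) (fun i => (hT.base i).1) j.isLt.le).trans ?_
        exact (level_eq_of_castLE q.isLt.le (fun _ => rfl) j.isLt.le).symm
      rw [e1, (hT.base j).1]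
      exact (transcendental_map_iff ψ).2 (h.transcendental (Fin.castLE q.isLt.le j))
    | right k =>
      refine transcendental_of_sum (hT.labelled.stable_level hG.stable_bot _)
        (fun c hc => (bot_le : ⊥ ≤ level G T _) (hk c hc)) ?_ (hT.new k)
      rw [hT.sum k, add_sub_cancel_left]
      exact hT.labelled.mem_level _
  let T' : Fin (q.val + r) → K := fun i => ⟨T i, subset_adjoin G _ ⟨i, rfl⟩⟩
  let A' : Fin (q.val + r) → K := fun i => ⟨A i, hAK i⟩
  have hT' : (fun i => K.val (T' i)) = T := rfl
  have hlev : ∀ m, (level G T' m).map K.val = level G T m := fun m => map_level K.val T' m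
  have htr' : ∀ i : Fin (q.val + r), Transcendental (level G T' i) (T' i) := by
    intro i
    rw [← transcendental_map_iff K.val, hlev]
    exact htr i
  have hL' : IsLabelled G (restrict σ' K hKs hKs') T' A' lab :=
    { pos := hT.labelled.pos
      mem := fun j => (map_mem_adjoin_image_iff K.val T' _ _).1 (hT.labelled.mem j)
      shift := fun j => (hT.labelled.shift j).imp
        (fun h => ⟨fun h0 => h.1 (congrArg Subtype.val h0), Subtype.ext h.2⟩) Subtype.ext }
  have hψK : ∀ x : level G t q, ψ x ∈ K := by
    intro x
    refine hT.level_le ?_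
    rw [← map_level]
    exact ⟨x, x.2, rfl⟩
  let ι : level G t q →ₐ[G] K := AlgHom.codRestrict (ψ.comp (level G t q).val) K.toSubalgebra hψK
  have hι : ∀ x, (ι x : E) = ψ x := fun x => rfl
  have hconst : ∀ c : K, restrict σ' K hKs hKs' c = c → c ∈ (⊥ : IntermediateField G K) := by
    intro c hc
    obtain ⟨g, hg⟩ := hk c (congrArg Subtype.val hc)
    exact ⟨g, Subtype.ext hg⟩
  have hshift : ∀ k : Fin r, restrict σ' K hKs hKs' (T' (Fin.natAdd q k)) =
      T' (Fin.natAdd q k) + A' (Fin.natAdd q k) := fun k => Subtype.ext (hT.sum k)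
  have hδ := genDepth_eq_depth_add_one h.algebraicIndependent (h.mem q)
  refine fun hopt => hopt ⟨K, inferInstance, inferInstance, restrict σ' K hKs hKs', ι, r, T', A',
    ⟨?_, ?_, ?_, ?_, ?_⟩, ?_, ⟨a q, h.mem q⟩, ⟨ψ (t q), hx⟩, rfl, ?_⟩
  · intro x y hxy
    refine Subtype.ext ?_
    change σ' (ψ x) = ψ y
    rw [← hψ, hxy]
  · intro j
    have h1 : t (Fin.castLE q.isLt.le j) ∈ level G t q := mem_level t j.isLt
    exact ⟨⟨_, h1⟩, rfl, Subtype.ext ((hT.base j).1.trans (hι ⟨_, h1⟩).symm)⟩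
  · intro j
    have h1 : a (Fin.castLE q.isLt.le j) ∈ level G t q :=
      level_mono t j.isLt.le (h.mem (Fin.castLE q.isLt.le j))
    exact ⟨⟨_, h1⟩, rfl, Subtype.ext ((hT.base j).2.1.trans (hι ⟨_, h1⟩).symm)⟩
  · intro k
    have hle : ⊥ ≤ level G T' (q + k) := bot_le
    refine ⟨htr' (Fin.natAdd q k), hL'.mem_level (Fin.natAdd q k), fun h0 => ?_, hshift k,
      fun c _ hc => hle (hconst c hc)⟩
    -- With coefficient zero the generator would be constant, hence in `G`.
    refine notMem_of_transcendental (htr' (Fin.natAdd q k)) (hle (hconst _ ?_))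
    rw [hshift, h0, add_zero]
  · refine map_injective K.val ?_
    rw [adjoin_map, ← Set.range_comp, ← AlgHom.fieldRange_eq_map, fieldRange_val]
    rfl
  -- The new depths are at most their labels, so at most `d`, and `d < δ(t_q) = δ(a_q) + 1`.
  · refine Finset.sup_le fun k _ => ?_
    have h1 := hL'.genDepth_le (algebraicIndependent_of_transcendental_level htr') (Fin.natAdd q k)
    have h2 := hT.le k
    omega
  · refine Subtype.ext ?_
    change σ' (ψ (t q)) - ψ (t q) = ψ (a q)
    rw [← hψ, hq, map_add, add_sub_cancel_left]

/-- If all sums are depth-optimal, then the tuple is free in each extension without new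
constants. -/
theorem IsPiSigmaDelta.isFree [CharZero E] (h : IsPiSigmaDelta σG σ t a) (ψ : F →ₐ[G] E)
    (hψ : ∀ x, ψ (σ x) = σ' (ψ x)) (hG : IsExtension σG σ')
    (hk : ∀ c, σ' c = c → c ∈ (⊥ : IntermediateField G E)) {q : ℕ} (hq : q ≤ e) :
    IsFree G σ' (ψ ∘ t) (genDepth G t a) q := by
  have hL := h.1.isLabelled ψ hψ
  induction q with
  | zero => exact fun d j hj => absurd hj (Nat.not_lt_zero _)
  | succ q ih =>
    have ih := ih (by omega)
    obtain ⟨j, rfl⟩ : ∃ j : Fin e, j.val = q := ⟨⟨q, hq⟩, rfl⟩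
    rcases h.1.step j with hj | hj
    · refine ih.succ_of_prod hL hG.stable_bot hk ((_root_.map_ne_zero ψ).2 hj.ne_zero) ?_ ?_
      · rw [Function.comp_apply, ← hψ, hj.shift, map_mul]
        rfl
      · rw [← map_level]
        exact (transcendental_map_iff ψ).2 hj.transcendental
    · have hs : σ' ((ψ ∘ t) j) = (ψ ∘ t) j + (ψ ∘ a) j := by
        rw [Function.comp_apply, ← hψ, hj.shift, map_add]
        rfl
      intro d i hi hd
      rw [hL.filt_succ_eq_of_sum hs]
      rcases Nat.lt_succ_iff_lt_or_eq.1 hi with hi | hi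
      · exact ih d i hi hd
      · obtain rfl : i = j := Fin.ext hi
        refine transcendental_of_sum ((hL.stable_filt hG.stable_bot _ d).sup hG.stable_bot
          (hL.stable_level hG.stable_bot _))
          (fun c hc => (bot_le : ⊥ ≤ filt G σ' _ d ⊔ level G (ψ ∘ t) i) (hk c hc)) ?_ fun hx => ?_
        · rw [hs, add_sub_cancel_left]
          exact (le_sup_right : level G (ψ ∘ t) i ≤ _) (hL.mem_level i)
        -- A sum that is not transcendental lies in the base field, so a finite tower of sums of
        -- depth at most `d` contains it, against depth-optimality.
        · obtain ⟨r, T, A, lab, hT, hxT⟩ := exists_isSumTower_of_mem_sup hL i.isLt.le ih hx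
          exact h.1.not_isDepthOptimal ψ hψ hG hk hj.shift hd hT hxT (h.2 i hj)

end Tower

/-! ### Unsolvable sums create no constants -/

section NewSum

variable {G : Type u} [Field G] {E : Type v} [Field E] [Algebra G E] [CharZero E] {σ : E ≃+* E}

/-- A constant fraction over `M` in an unsolvable sum `x` is the sum of a constant from `M` and a
proper fraction which is constant. -/
theorem exists_const_add_proper {M : IntermediateField G E} (hM : Stable σ M) {x : E}
    (hx : σ x - x ∈ M) (ht : Transcendental M x) (hn : ∀ z ∈ M, σ z - z ≠ σ x - x)
    {c : E} (hc : σ c = c) (hcM : c ∈ M ⊔ G⟮x⟯) :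
    ∃ b ∈ M, ∃ w, σ b = b ∧ σ w = w ∧ IsProper M x w ∧ c = b + w := by
  set β := σ x - x with hβ
  have hxb : σ x = 1 * x + β := by rw [hβ]; ring
  obtain ⟨A, hA, w, hw, rfl⟩ := exists_poly_add_proper hcM
  have h1 : (twist σ 1 β A - A).eval x = w - σ w := by
    rw [map_add, ← eval_twist hxb] at hc
    rw [eval_sub]
    linear_combination hc
  have h2 : twist σ 1 β A - A = 0 :=
    eq_zero_of_poly_eq_proper ht (hw.sub ht (hw.map hM one_ne_zero (one_mem M) hx hxb))
      (sub_mem (twist_mem_polys hM (one_mem M) hx hA) hA) h1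
  have h3 : ∀ n, (twist σ 1 β A).coeff n = A.coeff n := fun n => by rw [sub_eq_zero.1 h2]
  have h4 : σ w = w := by
    rw [h2, eval_zero] at h1
    exact (sub_eq_zero.1 h1.symm).symm
  have h5 : A.natDegree = 0 := by
    by_contra hd
    obtain ⟨m, hm⟩ := Nat.exists_eq_succ_of_ne_zero hd
    have e1 := h3 (m + 1)
    rw [coeff_twist_one (by omega), coeff_eq_zero_of_natDegree_lt (n := m + 1 + 1) (by omega),
      map_zero, mul_zero, zero_mul, add_zero] at e1
    have e2 := h3 m
    rw [coeff_twist_one hm.le, e1] at e2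
    have h0 : A.coeff (m + 1) ≠ 0 := by
      rw [← Nat.succ_eq_add_one, ← hm]
      exact fun h0 => hd (by rw [leadingCoeff_eq_zero.1 h0, natDegree_zero])
    have hm0 : ((m : E) + 1) ≠ 0 := Nat.cast_add_one_ne_zero m
    -- In positive degree the leading coefficient is constant, and the next coefficient yields this
    -- solution of the unsolvable equation.
    refine hn (-(A.coeff m / ((m + 1) * A.coeff (m + 1)))) (neg_mem (div_mem (mem_polys.1 hA m)
      (mul_mem (add_mem (_root_.natCast_mem M m) (one_mem M)) (mem_polys.1 hA (m + 1))))) ?_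
    rw [map_neg, map_div₀, map_mul, map_add, map_natCast, map_one, e1]
    field_simp
    linear_combination -e2
  rw [eq_C_of_natDegree_eq_zero h5, eval_C]
  refine ⟨A.coeff 0, mem_polys.1 hA 0, w, ?_, h4, hw, rfl⟩
  have := h3 0
  rwa [coeff_twist_one (by omega), coeff_eq_zero_of_natDegree_lt (n := 0 + 1) (by omega), map_zero,
    mul_zero, zero_mul, add_zero] at this

/-- An unsolvable sum does not create constants. -/
theorem const_mem_of_unsolvable {M : IntermediateField G E} (hM : Stable σ M) {x : E}
    (hx : σ x - x ∈ M) (ht : Transcendental M x) (hn : ∀ z ∈ M, σ z - z ≠ σ x - x)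
    {c : E} (hc : σ c = c) (hcM : c ∈ M ⊔ G⟮x⟯) : c ∈ M := by
  obtain ⟨b, hb, w, hbσ, hwσ, hw, rfl⟩ := exists_const_add_proper hM hx ht hn hc hcM
  by_cases hw0 : w = 0
  · rwa [hw0, add_zero]
  have hwM : w ∈ M ⊔ G⟮x⟯ := by
    have := sub_mem hcM ((le_sup_left : M ≤ M ⊔ G⟮x⟯) hb)
    rwa [add_sub_cancel_left] at this
  obtain ⟨b', hb', v, -, -, hv, e⟩ := exists_const_add_proper hM hx ht hn (c := w⁻¹)
    (by rw [map_inv₀, hwσ]) (inv_mem hwM)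
  obtain ⟨R, hR, Q, hQ, h1, h2, rfl⟩ := hw
  obtain ⟨S, hS, T, hT, k1, k2, rfl⟩ := hv
  -- If the proper constant `w` is nonzero, its inverse is an element of `M` plus a proper fraction.
  -- Multiplying by `w` makes `1` proper, which is absurd.
  have hprop : IsProper M x 1 := by
    refine ⟨R * (C b' * T + S), mul_mem hR (add_mem (mul_mem (C_mem_polys hb') hT) hS), Q * T,
      mul_mem hQ hT, mul_ne_zero h1 k1, ?_, ?_⟩
    · rw [degree_mul, degree_mul]
      have hle : (C b' * T + S).degree ≤ T.degree := by
        refine (degree_add_le _ _).trans (max_le ?_ k2.le)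
        rw [degree_mul]
        exact add_le_of_nonpos_left degree_C_le
      exact (add_le_add_right hle _).trans_lt (WithBot.add_lt_add_right (degree_ne_bot.2 k1) h2)
    · have hQ0 := eval_ne_zero ht hQ h1
      have hT0 := eval_ne_zero ht hT k1
      rw [← mul_inv_cancel₀ hw0, e]
      simp only [eval_mul, eval_add, eval_C]
      field_simp
  exact absurd (eq_zero_of_poly_eq_proper ht hprop (one_mem (polys M)) (by simp)) one_ne_zero

end NewSum

/-! ### Amalgamating two extensions without new constants -/

section Amalgam

variable {G : Type u} [Field G] {σG : G ≃+* G}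

/-- A difference field without new constants can be extended by a solution of `σ z - z = b`
without adding constants. -/
theorem exists_extension_of_sum {H : Type v} [Field H] [CharZero H] [Algebra G H] {σ : H ≃+* H}
    (hG : IsExtension σG σ) (hk : ∀ c, σ c = c → c ∈ (⊥ : IntermediateField G H)) (b : H) :
    ∃ (H' : Type v) (_ : Field H') (_ : Algebra G H') (σ' : H' ≃+* H') (j : H →ₐ[G] H') (z : H'),
      IsExtension σG σ' ∧ (∀ c, σ' c = c → c ∈ (⊥ : IntermediateField G H')) ∧
      (∀ x, j (σ x) = σ' (j x)) ∧ σ' z - z = j b := by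
  by_cases hb : ∃ z, σ z - z = b
  · obtain ⟨z, hz⟩ := hb
    exact ⟨H, inferInstance, inferInstance, σ, AlgHom.id G H, z, hG, hk, fun _ => rfl, hz⟩
  push Not at hb
  -- If there is no solution in `H`, an indeterminate serves as one: `σ` acts on coefficients and
  -- `X` is sent to `X + b`.
  let e : H[X] ≃+* H[X] := (mapEquiv σ).trans (algEquivAevalXAddC b).toRingEquiv
  let σ' : FractionRing H[X] ≃+* FractionRing H[X] := IsFractionRing.ringEquivOfRingEquiv e
  let j : H →ₐ[G] FractionRing H[X] := IsScalarTower.toAlgHom G H (FractionRing H[X])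
  have hj : ∀ x, j x = algebraMap H[X] (FractionRing H[X]) (C x) := fun x =>
    IsScalarTower.algebraMap_apply H H[X] (FractionRing H[X]) x
  set z := algebraMap H[X] (FractionRing H[X]) X with hz
  have hjσ : ∀ x, j (σ x) = σ' (j x) := by
    intro x
    rw [hj, hj, IsFractionRing.ringEquivOfRingEquiv_algebraMap]
    congr 1
    simp [e]
  have hzσ : σ' z - z = j b := by
    rw [hj, hz, IsFractionRing.ringEquivOfRingEquiv_algebraMap, ← map_sub]
    congr 1
    simp [e]
  have : CharZero (FractionRing H[X]) := charZero_of_injective_algebraMap j.injective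
  have hev : ∀ P : H[X], (P.map (j : H →+* FractionRing H[X])).eval z =
      algebraMap H[X] (FractionRing H[X]) P := by
    intro P
    induction P using Polynomial.induction_on' with
    | add P Q hP hQ => simp only [Polynomial.map_add, eval_add, hP, hQ, map_add]
    | monomial n a =>
      rw [map_monomial, eval_monomial, ← C_mul_X_pow_eq_monomial, map_mul, map_pow, ← hj]
      rfl
  have hst : Stable σ' j.fieldRange := by
    rintro _ ⟨x, rfl⟩
    exact ⟨σ x, hjσ x⟩
  have ht : Transcendental j.fieldRange z := by
    rw [transcendental_iff_polys]
    intro P hP h0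
    have h1 : P ∈ lifts (j : H →+* FractionRing H[X]) := by
      rw [lifts_iff_coeff_lifts]
      exact fun n => mem_polys.1 hP n
    obtain ⟨Q, rfl⟩ := (mem_lifts P).1 h1
    rw [hev, map_eq_zero_iff _ (IsFractionRing.injective H[X] _)] at h0
    rw [h0, Polynomial.map_zero]
  refine ⟨FractionRing H[X], inferInstance, inferInstance, σ', j, z, ?_, ?_, hjσ, hzσ⟩
  · intro g
    rw [← AlgHom.commutes j, ← hjσ, hG, AlgHom.commutes]
  · intro c hc
    have hcr : c ∈ j.fieldRange := by
      refine const_mem_of_unsolvable hst (x := z) ?_ ht ?_ hc ?_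
      · rw [hzσ]
        exact ⟨b, rfl⟩
      · rintro _ ⟨x, rfl⟩ hx
        refine hb x (j.injective ?_)
        change j (σ x - x) = j b
        rw [← hzσ, ← hx, map_sub, hjσ]
        rfl
      · obtain ⟨P, Q, -, rfl⟩ := IsFractionRing.div_surjective (A := H[X]) c
        have hpol : ∀ P : H[X], P.map (j : H →+* FractionRing H[X]) ∈ polys j.fieldRange := by
          intro P
          rw [mem_polys]
          intro n
          rw [coeff_map]
          exact ⟨_, rfl⟩
        rw [← hev, ← hev]
        exact div_mem (eval_mem_sup_simple (hpol P) z) (eval_mem_sup_simple (hpol Q) z)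
    obtain ⟨x, rfl⟩ := hcr
    obtain ⟨g, rfl⟩ := hk x (j.injective ((hjσ x).trans hc))
    exact ⟨g, (j.commutes g).symm⟩

variable {E : Type*} [Field E] [Algebra G E] {H : Type v} [Field H] [Algebra G H]

/-- Extension of an embedding of `K` to `K(s)`. -/
theorem exists_algHom_of_transcendental {K : IntermediateField G E} {s : E}
    (hs : Transcendental K s) (φ : K →ₐ[G] H) {z : H} (hz : Transcendental φ.fieldRange z) :
    ∃ φ' : (K ⊔ G⟮s⟯ : IntermediateField G E) →ₐ[G] H,
      (∀ (x : K) (y : (K ⊔ G⟮s⟯ : IntermediateField G E)), (y : E) = x → φ' y = φ x) ∧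
      ∀ y : (K ⊔ G⟮s⟯ : IntermediateField G E), (y : E) = s → φ' y = z := by
  let _ : Algebra K H := φ.toRingHom.toAlgebra
  have : IsScalarTower G K H := IsScalarTower.of_algebraMap_eq fun x => (φ.commutes x).symm
  have hz' : Transcendental K z := by
    rw [transcendental_iff]
    intro P hP
    rw [aeval_def, ← eval_map] at hP
    refine (Polynomial.map_eq_zero (algebraMap K H)).1
      (transcendental_iff_polys.1 hz _ (mem_polys.2 fun n => ?_) hP)
    rw [coeff_map]
    exact ⟨_, rfl⟩
  -- Both fields are identified with the rational functions over `K`.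
  let e : K⟮s⟯ ≃ₐ[K] K⟮z⟯ :=
    (RatFunc.algEquivOfTranscendental s hs).symm.trans (RatFunc.algEquivOfTranscendental z hz')
  let φ₀ : K⟮s⟯ →ₐ[K] H := (K⟮z⟯.val).comp (e : K⟮s⟯ →ₐ[K] K⟮z⟯)
  rw [← restrictScalars_adjoin_eq_sup]
  refine ⟨φ₀.restrictScalars G, fun x y hxy => ?_, fun y hy => ?_⟩
  · have : y = algebraMap K K⟮s⟯ x := Subtype.ext hxy
    rw [this]
    exact φ₀.commutes x
  · have : y = AdjoinSimple.gen K s := Subtype.ext hy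
    rw [this]
    change ((RatFunc.algEquivOfTranscendental z hz'
      ((RatFunc.algEquivOfTranscendental s hs).symm (AdjoinSimple.gen K s)) : K⟮z⟯) : H) = z
    rw [RatFunc.algEquivOfTranscendental_symm_gen, RatFunc.algEquivOfTranscendental_X]

/-- The embedding of `F` and the partial embedding of `E`, defined on `K`, into a common difference
field whose constants lie in `G`. -/
def HasAmalgam {G : Type u} [Field G] (σG : G ≃+* G) {F : Type v} [Field F] [Algebra G F]
    (σ : F ≃+* F) {E : Type v} [Field E] [Algebra G E] (σ' : E ≃+* E) {L : IntermediateField G F}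
    (ι : L →ₐ[G] E) (K : IntermediateField G E) : Prop :=
  ∃ (H : Type v) (_ : Field H) (_ : Algebra G H) (σH : H ≃+* H) (ψ : F →ₐ[G] H) (φ : K →ₐ[G] H),
    IsExtension σG σH ∧ (∀ c, σH c = c → c ∈ (⊥ : IntermediateField G H)) ∧
    (∀ x, ψ (σ x) = σH (ψ x)) ∧ (∀ x y : K, σ' x = y → σH (φ x) = φ y) ∧
    ∀ (x : L) (y : K), ι x = y → φ y = ψ x

variable {F : Type v} [Field F] [Algebra G F] {σ : F ≃+* F} {E : Type v} [Field E] [Algebra G E]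
  {σ' : E ≃+* E} {L : IntermediateField G F} {ι : L →ₐ[G] E}

/-- Before any sum is adjoined, `F` itself is the common field. -/
theorem hasAmalgam_fieldRange (hG : IsExtension σG σ)
    (hk : ∀ c, σ c = c → c ∈ (⊥ : IntermediateField G F))
    (hι : ∀ x y : L, σ (x : F) = y → σ' (ι x) = ι y) (hL : Stable σ L) :
    HasAmalgam σG σ σ' ι ι.fieldRange := by
  let e : L ≃ₐ[G] ι.fieldRange := AlgEquiv.ofInjectiveField ι
  have he : ∀ (x : L) (y : ι.fieldRange), ι x = y → e.symm y = x := by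
    intro x y hxy
    rw [AlgEquiv.symm_apply_eq]
    exact Subtype.ext hxy.symm
  refine ⟨F, inferInstance, inferInstance, σ, AlgHom.id G F, L.val.comp e.symm, hG, hk,
    fun _ => rfl, ?_, fun x y hxy => congrArg L.val (he x y hxy)⟩
  rintro ⟨_, x, rfl⟩ y hxy
  have h1 := hι x ⟨σ x, hL x x.2⟩ rfl
  have h2 := he _ y (h1.symm.trans hxy)
  have h3 := he x ⟨ι x, x, rfl⟩ rfl
  change σ (e.symm ⟨ι x, x, rfl⟩ : L) = (e.symm y : L)
  rw [h2, h3]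

/-- The common field is enlarged, if necessary, by a solution `z` of the image of `σ' s - s = b`.
This `z` is transcendental over the image of `K`: otherwise it would lie there, giving `x ∈ K` with
`σ' x - x = b`, and the constant `s - x` would force `s ∈ K`. Hence `s ↦ z` extends the embedding.
-/
theorem HasAmalgam.sup_simple [CharZero G] {K : IntermediateField G E} (h : HasAmalgam σG σ σ' ι K)
    (hG : Stable σ' (⊥ : IntermediateField G E)) (hK : Stable σ' K) (hιK : ∀ x, ι x ∈ K) {s b : E}
    (hs : IsSigmaStep σ' K s b) : HasAmalgam σG σ σ' ι (K ⊔ G⟮s⟯) := by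
  obtain ⟨H, _, _, σH, ψ, φ, hGH, hkH, hψ, hφ, hι⟩ := h
  have : CharZero H := charZero_of_injective_algebraMap (algebraMap G H).injective
  obtain ⟨H', _, _, σH', j, z, hG', hk', hj, hz⟩ := exists_extension_of_sum hGH hkH (φ ⟨b, hs.mem⟩)
  have : CharZero H' := charZero_of_injective_algebraMap (algebraMap G H').injective
  have hjφ : ∀ x y : K, σ' x = y → σH' (j (φ x)) = j (φ y) := by
    intro x y hxy
    rw [← hj, hφ x y hxy]
  have hM : Stable σH' (j.comp φ).fieldRange := by
    rintro _ ⟨x, rfl⟩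
    exact ⟨⟨σ' x, hK x x.2⟩, (hjφ x _ rfl).symm⟩
  have hzM : Transcendental (j.comp φ).fieldRange z := by
    refine transcendental_of_sum hM (fun c hc => (bot_le : ⊥ ≤ (j.comp φ).fieldRange) (hk' c hc))
      (by rw [hz]; exact ⟨⟨b, hs.mem⟩, rfl⟩) ?_
    rintro ⟨x, rfl⟩
    change σH' (j (φ x)) - j (φ x) = _ at hz
    rw [hjφ x ⟨σ' x, hK x x.2⟩ rfl, ← map_sub, ← map_sub] at hz
    have h1 : σ' x - x = b := congrArg Subtype.val (φ.injective (j.injective hz))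
    have h2 : s - x ∈ K := by
      refine hs.const _ (sub_mem (mem_adjoin_simple_self K s) ?_) ?_
      · exact (adjoin K {s}).algebraMap_mem x
      · rw [map_sub, hs.shift, ← h1]
        ring
    refine notMem_of_transcendental hs.transcendental ?_
    have := add_mem h2 x.2
    rwa [sub_add_cancel] at this
  obtain ⟨φ', hφ1, hφ2⟩ := exists_algHom_of_transcendental hs.transcendental (j.comp φ) hzM
  have hle : K ≤ K ⊔ G⟮s⟯ := le_sup_left
  have hst : Stable σ' (K ⊔ G⟮s⟯) := hK.sup_simple hG (apply_mem_of_sum (by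
    rw [hs.shift, add_sub_cancel_left]
    exact hs.mem))
  refine ⟨H', inferInstance, inferInstance, σH', j.comp ψ, φ', hG', hk', fun x => ?_, ?_,
    fun x y hxy => ?_⟩
  · change j (ψ (σ x)) = σH' (j (ψ x))
    rw [hψ, hj]
  · have e : adjoin G (K ∪ {s} : Set E) = K ⊔ G⟮s⟯ := by rw [adjoin_union, adjoin_self]
    have key : ∀ x ∈ adjoin G (K ∪ {s} : Set E), ∀ hx : x ∈ K ⊔ G⟮s⟯,
        σH' (φ' ⟨x, hx⟩) = φ' ⟨σ' x, hst x hx⟩ := by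
      intro x hx
      have hφK : ∀ x (hx : x ∈ K), φ' ⟨x, hle hx⟩ = j (φ ⟨x, hx⟩) :=
        fun x hx => hφ1 ⟨x, hx⟩ _ rfl
      induction hx using adjoin_induction with
      | mem x hx =>
        intro _
        rcases hx with hx | rfl
        · rw [hφK x hx, hφK _ (hK x hx), hjφ _ ⟨σ' x, hK x hx⟩ rfl]
        · have h1 : (⟨σ' x, hst x ‹_›⟩ : (K ⊔ G⟮x⟯ : IntermediateField G E)) =
              ⟨x, self_mem_sup_simple K x⟩ + ⟨b, hle hs.mem⟩ := Subtype.ext hs.shift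
          rw [h1, map_add, hφ2 _ rfl, hφK b hs.mem, ← hz]
          ring
      | algebraMap g =>
        intro _
        have h1 : algebraMap G E g ∈ K := K.algebraMap_mem g
        rw [hφK _ h1, hφK _ (hK _ h1), hjφ _ ⟨σ' _, hK _ h1⟩ rfl]
      | add x y hx hy ihx ihy =>
        intro _
        rw [e] at hx hy
        have h1 := congrArg₂ (· + ·) (ihx hx) (ihy hy)
        simp only [← map_add] at h1
        refine h1.trans (congrArg φ' (Subtype.ext (map_add σ' x y).symm))
      | inv x hx ihx =>
        intro _
        rw [e] at hx
        have h1 := congrArg (·⁻¹) (ihx hx)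
        simp only [← map_inv₀] at h1
        refine h1.trans (congrArg φ' (Subtype.ext (map_inv₀ σ' x).symm))
      | mul x y hx hy ihx ihy =>
        intro _
        rw [e] at hx hy
        have h1 := congrArg₂ (· * ·) (ihx hx) (ihy hy)
        simp only [← map_mul] at h1
        refine h1.trans (congrArg φ' (Subtype.ext (map_mul σ' x y).symm))
    intro x y hxy
    rw [key x (e.ge x.2) x.2]
    congr 1
    exact Subtype.ext hxy
  · rw [hφ1 ⟨ι x, hιK x⟩ y hxy.symm]
    change j (φ _) = j (ψ x)
    rw [hι x _ rfl]

variable {e m r : ℕ} {t a : Fin e → F} {hm : m ≤ e}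

theorem IsSigmaStarOver.fieldRange {ι : level G t m →ₐ[G] E} {T A : Fin (m + r) → E}
    (h : IsSigmaStarOver σ t a hm σ' ι T A) : ι.fieldRange = level G T m := by
  refine le_antisymm ?_ (adjoin_le_iff.2 ?_)
  · have h1 : level G t m ≤ ((level G T m).comap ι).map (level G t m).val := by
      refine adjoin_le_iff.2 ?_
      rintro _ ⟨j, hj, rfl⟩
      obtain ⟨x, hx, hxT⟩ := h.gen ⟨j, hj⟩
      refine ⟨x, ?_, hx⟩
      change ι x ∈ level G T m
      rw [← hxT]
      exact mem_level T hj
    rintro _ ⟨x, rfl⟩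
    obtain ⟨y, hy, hyx⟩ := h1 x.2
    obtain rfl : y = x := Subtype.ext hyx
    exact hy
  · rintro _ ⟨j, hj, rfl⟩
    obtain ⟨x, -, hxT⟩ := h.gen ⟨j, hj⟩
    exact ⟨x, hxT.symm⟩

theorem IsSigmaStarOver.isExtension {ι : level G t m →ₐ[G] E} {T A : Fin (m + r) → E}
    (h : IsSigmaStarOver σ t a hm σ' ι T A) (hG : IsExtension σG σ) : IsExtension σG σ' := by
  intro g
  rw [← ι.commutes, ← ι.commutes]
  exact h.comm _ _ (hG g)

/-- Each extension of the initial part `G(t₁)…(tₘ)` by sums can be amalgamated with `F`. -/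
theorem IsSigmaStarOver.hasAmalgam [CharZero G] {ι : level G t m →ₐ[G] E} {T A : Fin (m + r) → E}
    (h : IsSigmaStarOver σ t a hm σ' ι T A) (hF : IsPiSigmaStar σG σ t a) :
    HasAmalgam σG σ σ' ι ⊤ := by
  have hG := (h.isExtension hF.isExtension).stable_bot
  have hL : Stable σ (level G t m) :=
    stable_level hF.isExtension.stable_bot hF.mem (fun j => (hF.shift j).imp And.right id) m
  have key : ∀ k ≤ r, Stable σ' (level G T (m + k)) ∧ (∀ x, ι x ∈ level G T (m + k)) ∧
      HasAmalgam σG σ σ' ι (level G T (m + k)) := by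
    intro k
    induction k with
    | zero =>
      intro _
      rw [add_zero, ← h.fieldRange]
      refine ⟨?_, fun x => ⟨x, rfl⟩,
        hasAmalgam_fieldRange hF.isExtension (fun c hc => hF.const hc) h.comm hL⟩
      rintro _ ⟨x, rfl⟩
      exact ⟨⟨σ x, hL x x.2⟩, (h.comm x _ rfl).symm⟩
    | succ k ih =>
      intro hk
      obtain ⟨h1, h2, h3⟩ := ih (by omega)
      have hs := h.step ⟨k, hk⟩
      have e1 : level G T (m + (k + 1)) = level G T (m + k) ⊔ G⟮T (Fin.natAdd m ⟨k, hk⟩)⟯ :=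
        level_succ T (Fin.natAdd m ⟨k, hk⟩)
      rw [e1]
      refine ⟨h1.sup_simple hG (apply_mem_of_sum ?_),
        fun x => (le_sup_left : level G T (m + k) ≤ _) (h2 x), h3.sup_simple hG h1 h2 hs⟩
      rw [hs.shift, add_sub_cancel_left]
      exact hs.mem
  have := (key r le_rfl).2.2
  rwa [level_eq_adjoin_range, h.top] at this

end Amalgam

/-! ### Depths in an extension of an initial part -/

section Base

variable {G : Type u} [Field G] {F : Type v} [Field F] [Algebra G F] {σG : G ≃+* G} {σ : F ≃+* F}
  {E : Type v} [Field E] [Algebra G E] {σ' : E ≃+* E} {e m r : ℕ} {t a : Fin e → F} {hm : m ≤ e}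
  {ι : level G t m →ₐ[G] E} {T A : Fin (m + r) → E}

/-- The generators of an extension by sums are algebraically independent, and the generators of the
initial part keep their depths. -/
theorem IsSigmaStarOver.genDepth_eq (h : IsSigmaStarOver σ t a hm σ' ι T A)
    (hF : IsPiSigmaStar σG σ t a) : AlgebraicIndependent G T ∧
      ∀ j : Fin m, genDepth G T A (Fin.castAdd r j) = genDepth G t a (Fin.castLE hm j) := by
  choose x hx hxT using h.gen
  choose b hb hbA using h.coeff
  have hlev : ∀ j : Fin m, (level G x j).map (level G t m).val = level G t j := by
    intro j
    rw [map_level]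
    exact (level_eq_of_castLE hm (fun i => (hx i).symm) j.isLt.le).symm
  have hbl : ∀ j : Fin m, b j ∈ level G x j := by
    intro j
    have h1 : a (Fin.castLE hm j) ∈ level G t j := hF.mem (Fin.castLE hm j)
    rw [← hb j, ← hlev j] at h1
    obtain ⟨y, hy, hyb⟩ := h1
    rwa [← Subtype.ext (a1 := y) (a2 := b j) hyb]
  have hT : AlgebraicIndependent G T := by
    refine algebraicIndependent_of_transcendental_level fun i => ?_
    induction i using Fin.addCases with
    | left j =>
      have h1 : level G T (Fin.castAdd r j) = (level G x j).map ι := by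
        rw [map_level]
        exact level_eq_of_castLE (Nat.le_add_right m r) hxT j.isLt.le
      rw [h1, hxT, transcendental_map_iff, ← transcendental_map_iff (level G t m).val, hlev]
      change Transcendental _ (x j : F)
      rw [hx]
      exact hF.transcendental (Fin.castLE hm j)
    | right k => exact (h.step k).transcendental
  refine ⟨hT, fun j => ?_⟩
  exact (genDepth_eq_of_map ι (Nat.le_add_right m r) hT hxT hbA hbl j).trans
    (genDepth_eq_of_map (level G t m).val hm hF.algebraicIndependent (fun i => (hx i).symm)
      (fun i => (hb i).symm) hbl j).symm

end Base

/-! ### Reordering -/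

section Reorder

variable {G : Type u} [Field G] {F : Type v} [Field F] [Algebra G F] {σG : G ≃+* G} {σ : F ≃+* F}
  {e : ℕ} {t a : Fin e → F} {τ : Equiv.Perm (Fin e)}

/-- An admissible reordering of a `ΠΣ*`-extension is a `ΠΣ*`-extension. -/
theorem IsPiSigmaStar.comp_perm (h : IsPiSigmaStar σG σ t a) (hτ : IsAdmissible G t a τ) :
    IsPiSigmaStar σG σ (t ∘ τ) (a ∘ τ) where
  isExtension := h.isExtension
  step i := by
    have htr : Transcendental (level G (t ∘ τ) i) ((t ∘ τ) i) :=
      transcendental_of_algebraicIndependent (h.algebraicIndependent.comp _ τ.injective)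
        (lt_irrefl i.val)
    have hc : ∀ c ∈ adjoin (level G (t ∘ τ) i) {(t ∘ τ) i}, σ c = c → c ∈ level G (t ∘ τ) i :=
      fun c _ hc => (bot_le : ⊥ ≤ level G (t ∘ τ) i) (h.const hc)
    exact (h.step (τ i)).imp (fun hs => ⟨htr, hτ i, hs.ne_zero, hs.shift, hc⟩)
      fun hs => ⟨htr, hτ i, hs.ne_zero, hs.shift, hc⟩
  top := by rw [τ.surjective.range_comp, h.top]

/-- The sums in an admissible reordering of a `ΠΣ^δ`-extension are depth-optimal. -/
theorem IsPiSigmaDelta.isDepthOptimal_comp_perm [CharZero G] (h : IsPiSigmaDelta σG σ t a)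
    (hτ : IsAdmissible G t a τ) {i : Fin e} (hi : σ (t (τ i)) = t (τ i) + a (τ i)) :
    IsDepthOptimal G σ (t ∘ τ) (a ∘ τ) i := by
  have hF := h.1.comp_perm hτ
  rintro ⟨E, _, _, σ', ι, r, T, A, hS, hext, f, g, hf, hg⟩
  obtain ⟨hTi, hbase⟩ := hS.genDepth_eq hF
  obtain ⟨H, _, _, σH, ψ, φ, hG, hk, hψ, hφ, hι⟩ := hS.hasAmalgam hF
  have : CharZero H := charZero_of_injective_algebraMap (algebraMap G H).injective
  let θ : E →ₐ[G] H := φ.comp (topEquiv (F := G) (E := E)).symm.toAlgHom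
  have hθ : ∀ x, σH (θ x) = θ (σ' x) := fun x => hφ ⟨x, mem_top⟩ ⟨σ' x, mem_top⟩ rfl
  have hθι : ∀ x, θ (ι x) = ψ x := fun x => hι x ⟨ι x, mem_top⟩ rfl
  have hL := h.1.isLabelled ψ hψ
  have hfree := h.isFree ψ hψ hG hk le_rfl
  set δ := genDepth G t a with hδ
  set N := filt G σH (gens (ψ ∘ t) δ e) with hN
  have hθT : ∀ j : Fin i.val, θ (T (Fin.castAdd r j)) = ψ (t (τ (Fin.castLE i.isLt.le j))) := by
    intro j
    obtain ⟨x, hx, hxT⟩ := hS.gen j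
    rw [hxT, hθι, hx]
    rfl
  -- Each generator of the refuting extension lands in the filtration at the level of its depth: old
  -- generators keep their depth under reordering, and new ones are sums over the preceding level.
  have hmem : ∀ k, θ (T k) ∈ N (genDepth G T A k) := by
    intro k
    induction k using WellFoundedLT.induction with
    | ind k ih =>
      induction k using Fin.addCases with
      | left j =>
        rw [hbase, genDepth_comp_perm h.1.algebraicIndependent h.1.mem hτ, hθT]
        exact hL.gen_mem_filt (Fin.isLt _) le_rfl
      | right k =>
        have hs := hS.step k
        have h1 := coeff_mem_adjoin_genDepth_lt hTi (i := Fin.natAdd i.val k) hs.mem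
        have h0 := genDepth_pos (G := G) (T := T) (A := A) (Fin.natAdd i.val k)
        obtain ⟨d, hd⟩ : ∃ d, genDepth G T A (Fin.natAdd i.val k) = d + 1 :=
          ⟨genDepth G T A (Fin.natAdd i.val k) - 1, by omega⟩
        rw [hd] at h1 ⊢
        refine mem_filt_succ_of_sum ?_
        rw [hθ, hs.shift, map_add, add_sub_cancel_left]
        refine (adjoin_le_iff.2 ?_ : _ ≤ N d) ((map_mem_adjoin_image_iff θ T _ _).2 h1)
        rintro _ ⟨l, ⟨hl, hld⟩, rfl⟩
        exact filt_mono _ (Nat.lt_succ_iff.1 hld) (ih l hl)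
  set D := depth G (t ∘ τ) (a ∘ τ) ((a ∘ τ) i) with hD
  have hDδ : δ (τ i) = D + 1 := by
    rw [← genDepth_eq_depth_add_one hF.algebraicIndependent (hF.mem i),
      genDepth_comp_perm h.1.algebraicIndependent h.1.mem hτ]
  -- The old generators of the extension are images of some `t j` with `j ≠ τ i`; the new ones have
  -- depth at most `D`.
  have hgm : θ g ∈ N D ⊔ adjoin G ((ψ ∘ t) '' {τ i}ᶜ) := by
    have h1 : g ∈ adjoin G (T '' Set.univ) := by
      rw [Set.image_univ, hS.top]
      exact mem_top
    refine (adjoin_le_iff.2 ?_ : _ ≤ N D ⊔ adjoin G ((ψ ∘ t) '' {τ i}ᶜ))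
      ((map_mem_adjoin_image_iff θ T _ _).2 h1)
    rintro _ ⟨k, -, rfl⟩
    induction k using Fin.addCases with
    | left j =>
      refine (le_sup_right : adjoin G _ ≤ _) (subset_adjoin G _
        ⟨τ (Fin.castLE i.isLt.le j), fun hj => ?_, (hθT j).symm⟩)
      exact absurd (congrArg Fin.val (τ.injective hj)) (ne_of_lt j.isLt)
    | right k =>
      refine (le_sup_left : N D ≤ _) (filt_mono _ ?_ (hmem (Fin.natAdd i.val k)))
      exact (Finset.le_sup (f := fun k => genDepth G T A (Fin.natAdd i.val k))
        (Finset.mem_univ k)).trans hext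
  -- Both elements solve the same difference equation, so they differ by a constant, which lies in
  -- `G`.
  have hc : σH (θ g - ψ (t (τ i))) = θ g - ψ (t (τ i)) := by
    have h1 : σH (θ g) - θ g = ψ (a (τ i)) := by
      rw [hθ, ← map_sub, hg, hθι, hf]
      rfl
    rw [map_sub, ← hψ, hi, map_add]
    linear_combination h1
  -- Since `t (τ i)` has depth `D + 1`, freeness at level `D` applies to it, and exchange replaces
  -- its predecessors in the original order by all other generators.
  refine notMem_of_transcendental (transcendental_sup_compl (M := N D) (T := ψ ∘ t) (fun j => ?_)
    (hfree D (τ i) (Fin.isLt _) (by omega))) ?_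
  · by_cases hj : δ j ≤ D
    · exact Or.inl (hL.gen_mem_filt j.isLt hj)
    · exact Or.inr (hfree D j j.isLt (by omega))
  · have h1 := sub_mem hgm ((bot_le : ⊥ ≤ N D ⊔ adjoin G ((ψ ∘ t) '' {τ i}ᶜ)) (hk _ hc))
    rwa [sub_sub_cancel] at h1

theorem IsPiSigmaDelta.comp_perm [CharZero G] (h : IsPiSigmaDelta σG σ t a)
    (hτ : IsAdmissible G t a τ) : IsPiSigmaDelta σG σ (t ∘ τ) (a ∘ τ) :=
  ⟨h.1.comp_perm hτ, fun _ hi => h.isDepthOptimal_comp_perm hτ hi.shift⟩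

end Reorder

end DiffField

theorem mainTheorem2 {G : Type u} [Field G] [CharZero G] {F : Type v} [Field F] [Algebra G F]
    (σG : G ≃+* G) (σ : F ≃+* F) {e : ℕ} (t a : Fin e → F)
    (h : DiffField.IsPiSigmaStar σG σ t a)
    (τ : Equiv.Perm (Fin e)) (hτ : DiffField.IsAdmissible G t a τ) :
    DiffField.IsPiSigmaStar σG σ (t ∘ τ) (a ∘ τ) ∧
      (DiffField.IsPiSigmaDelta σG σ t a ↔ DiffField.IsPiSigmaDelta σG σ (t ∘ τ) (a ∘ τ)) := by
  refine ⟨h.comp_perm hτ, fun hδ => hδ.comp_perm hτ, fun hδ => ?_⟩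
  have ht : ∀ x : Fin e → F, (x ∘ τ) ∘ τ.symm = x := fun x => by
    funext i
    simp
  -- Undoing the reordering is admissible because the original tower satisfies `a i ∈ G(t₁)…(tᵢ₋₁)`.
  have hτ' : DiffField.IsAdmissible G (t ∘ τ) (a ∘ τ) τ.symm := by
    intro i
    change ((a ∘ τ) ∘ τ.symm) i ∈ _
    rw [ht, ht]
    exact h.mem i
  have := hδ.comp_perm hτ'
  rwa [ht, ht] at this
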